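/- Let $\Omega\subset\mathbb R^2$ be a bounded polygonal domain, i.e. a nonempty connected open set with $\operatorname{int}\overline\Omega=\Omega$ whose closure is a finite union of nondegenerate closed triangles, and let $u(x_1,x_2)=x_1^2+x_2^2$. For a conforming triangulation $\mathcal T$ of $\overline\Omega$ into closed triangles (elements), let $h$ be the maximal diameter of its elements and let $X_h$ be the space of continuous functions on $\overline\Omega$ that are affine on each element. Write $|K|$ for the area of $K$ and $|v|_{H^1(S)}=\big(\int_S|\nabla v|^2\,dx\big)^{1/2}$. A (straight) band in $\mathcal T$ consists of elements $K_0,\dots,K_N$ and $\tilde K_1,\dots,\tilde K_N$ of $\mathcal T$, $N\ge 1$, of the following form: there are points $p_0,\dots,p_{N+1}$, consecutively ordered on a straight line, and points $q_0,\dots,q_N$ strictly on one side of that line, such that $K_i$ is the triangle $p_i\,p_{i+1}\,q_i$ and its maximum angle $\alpha_i$ is at $q_i$ ($0\le i\le N$), and $\tilde K_i$ is the triangle $p_i\,q_{i-1}\,q_i$ and its maximum angle $\tilde\alpha_i$ is at $p_i$ ($1\le i\le N$). Its edge $\Gamma$ is the segment $p_0p_{N+1}$, and $L=|p_{N+1}-p_0|$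 is its length. Two bands are disjoint if they have no element in common. **Theorem.** Let $\alpha\in[0,1]$ and $C(u)\in\mathbb R$. There are constants $C_L,C_1>0$, depending only on $\Omega$, $\alpha$ and $C(u)$, and for all constants $C_K,C_\alpha$ there is a constant $C_2>0$, depending only on $\Omega,\alpha,C(u),C_K,C_\alpha$, such that the following holds for every conforming triangulation $\mathcal T$ of $\overline\Omega$ and every $U\in X_h$ satisfying $$|u-U|_{H^1(\Omega)}\le C(u)\,h^\alpha .$$ Let $\mathcal B_1,\dots,\mathcal B_{N_{\mathcal B}}$ be pairwise disjoint bands in $\mathcal T$, where $\mathcal B_b$ consists of the elements $K_0^b,\dots,K_{N_b}^b$ and $\tilde K_1^b,\dots,\tilde K_{N_b}^b$, has edge length $L_b$ and maximum angles $\alpha_i^b$, $\tilde\alpha_i^b$, such that for all $b=1,\dots,N_{\mathcal B}$ and $i=1,\dots,N_b$ $$|\tilde K_i^b|\le C_K|K_i^b|,\qquad |\tilde K_i^b|\le C_K|K_{i-1}^b|,\qquad \sin(\pi-\alpha_{i-1}^b)\le C_\alpha\sin(\pi-\tilde\alpha_i^b),$$ and $L_b\ge C_L h^{2\alpha/5}$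 for all $b$. Then, with $\mathbb B=\bigcup_{b=1}^{N_{\mathcal B}}\mathcal B_b$, there are real numbers $\mathcal A_1,\mathcal A_2$ with $$|u-U|_{H^1(\mathbb B)}\ge \mathcal A_1-\mathcal A_2,$$ $$\mathcal A_1\ge C_1\Big(\sum_{b=1}^{N_{\mathcal B}}\ \min_{i=1,\dots,N_b}\frac{1}{\sin^2(\pi-\tilde\alpha_i^b)}\ \min_{i=1,\dots,N_b}|\tilde K_i^b|\ L_b^2N_b^{-1}\Big)^{1/2},\qquad |\mathcal A_2|\le C_2h^\alpha .$$ -/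

import Mathlib

open Set MeasureTheory

noncomputable section

namespace FEMBand

/-- The Euclidean plane. -/
abbrev Plane := EuclideanSpace ℝ (Fin 2)

open Classical in
/-- The triangle with vertices `a, b, c`, encoded by its set of vertices. -/
def tri (a b c : Plane) : Finset Plane := {a, b, c}

/-- The closed triangle (as a point set) with vertex set `s`. -/
def body (s : Finset Plane) : Set Plane := convexHull ℝ (s : Set Plane)

/-- The area `|K|` of a triangle. -/
def area (s : Finset Plane) : ℝ := volume.real (body s)

/-- A bounded polygonal domain: a nonempty connected open set, without slits, whose closure is a
finite union of nondegenerate closed triangles. -/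
structure IsPolygonalDomain (Ω : Set Plane) : Prop where
  isOpen : IsOpen Ω
  isConnected : IsConnected Ω
  interior_closure : interior (closure Ω) = Ω
  polygonal : ∃ F : Finset (Finset Plane),
    (∀ s ∈ F, s.card = 3 ∧ AffineIndependent ℝ ((↑) : s → Plane)) ∧
      closure Ω = ⋃ s ∈ F, body s

/-- A conforming triangulation: a finite geometric simplicial complex (two of its simplices meet in
a common face or not at all) whose underlying space is `closure Ω`. -/
structure IsTriangulation (T : Geometry.SimplicialComplex ℝ Plane) (Ω : Set Plane) : Prop where
  finite : T.faces.Finite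
  space_eq : T.space = closure Ω

/-- The elements of a triangulation are its two-dimensional simplices. -/
def elements (T : Geometry.SimplicialComplex ℝ Plane) : Set (Finset Plane) :=
  {s ∈ T.faces | s.card = 3}

/-- `h` is the maximal diameter of the elements of `T`. -/
def IsMeshSize (T : Geometry.SimplicialComplex ℝ Plane) (h : ℝ) : Prop :=
  IsGreatest ((fun s => Metric.diam (body s)) '' elements T) h

/-- The discrete space `X_h`: continuous functions on the triangulated set which are affine on each
element. (Values outside the triangulated set are irrelevant.) -/
def X (T : Geometry.SimplicialComplex ℝ Plane) : Set (Plane → ℝ) :=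
  {U | ContinuousOn U T.space ∧
    ∀ s ∈ elements T, ∃ f : Plane →ᵃ[ℝ] ℝ, EqOn U f (body s)}

/-- The `H¹` seminorm `|f|_{H¹(S)} = (∫_S |∇f|²)^{1/2}`. It is only applied to continuous functions
which are smooth on each element of a triangulation, whose weak gradient is the almost everywhere
defined classical gradient. -/
def h1Seminorm (S : Set Plane) (f : Plane → ℝ) : ℝ :=
  Real.sqrt (∫ x in S, ‖gradient f x‖ ^ 2)

/-- The function `u(x₁, x₂) = x₁² + x₂²`. -/
def uExact (x : Plane) : ℝ := x 0 ^ 2 + x 1 ^ 2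

/-- A straight band of elements of `T`. The points `p 0, …, p (N+1)` are consecutive points of a
line (the edge `Γ` of the band is the segment from `p 0` to `p (N+1)`), the points `q 0, …, q N` lie
strictly on one side of this line (values of `p` and `q` at larger indices are irrelevant).
The band consists of the elements `K i` with vertices `p i, p (i+1), q i` for `0 ≤ i ≤ N`,
and of the elements `Kt i` with vertices `p i, q (i-1), q i` for `1 ≤ i ≤ N`.
The maximum angle of `K i` is at `q i`, so that the longest edge of `K i` lies on `Γ`,
and the maximum angle of `Kt i` is at `p i`, on `Γ`. -/
structure Band (T : Geometry.SimplicialComplex ℝ Plane) where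
  N : ℕ
  one_le_N : 1 ≤ N
  p : ℕ → Plane
  q : ℕ → Plane
  /-- the unit vector in the direction of `Γ` -/
  g : Plane
  norm_g : ‖g‖ = 1
  straight : ∀ i ≤ N, ∃ ℓ : ℝ, 0 < ℓ ∧ p (i + 1) = p i + ℓ • g
  one_side : ∃ n : Plane, inner ℝ n g = 0 ∧ ∀ i ≤ N, 0 < inner ℝ n (q i - p 0)
  K_mem : ∀ i ≤ N, tri (p i) (p (i + 1)) (q i) ∈ elements T
  Kt_mem : ∀ i ∈ Finset.Icc 1 N, tri (p i) (q (i - 1)) (q i) ∈ elements T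
  K_maxAngle : ∀ i ≤ N,
    EuclideanGeometry.angle (q i) (p i) (p (i + 1)) ≤
      EuclideanGeometry.angle (p i) (q i) (p (i + 1)) ∧
    EuclideanGeometry.angle (p i) (p (i + 1)) (q i) ≤
      EuclideanGeometry.angle (p i) (q i) (p (i + 1))
  Kt_maxAngle : ∀ i ∈ Finset.Icc 1 N,
    EuclideanGeometry.angle (p i) (q (i - 1)) (q i) ≤
      EuclideanGeometry.angle (q (i - 1)) (p i) (q i) ∧
    EuclideanGeometry.angle (q (i - 1)) (q i) (p i) ≤
      EuclideanGeometry.angle (q (i - 1)) (p i) (q i)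

namespace Band

variable {T : Geometry.SimplicialComplex ℝ Plane}

/-- The element `K_i`, `0 ≤ i ≤ N`. -/
def K (B : Band T) (i : ℕ) : Finset Plane := tri (B.p i) (B.p (i + 1)) (B.q i)

/-- The element `K̃_i`, `1 ≤ i ≤ N`. -/
def Kt (B : Band T) (i : ℕ) : Finset Plane := tri (B.p i) (B.q (i - 1)) (B.q i)

/-- The maximum angle `α_i` of `K_i`. -/
def α (B : Band T) (i : ℕ) : ℝ :=
  EuclideanGeometry.angle (B.p i) (B.q i) (B.p (i + 1))

/-- The maximum angle `α̃_i` of `K̃_i`. -/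
def αt (B : Band T) (i : ℕ) : ℝ :=
  EuclideanGeometry.angle (B.q (i - 1)) (B.p i) (B.q i)

/-- The set of all elements of the band. -/
def elems (B : Band T) : Set (Finset Plane) :=
  {s | (∃ i ≤ B.N, s = B.K i) ∨ ∃ i ∈ Finset.Icc 1 B.N, s = B.Kt i}

/-- The point set covered by the band. -/
def region (B : Band T) : Set Plane := ⋃ s ∈ B.elems, body s

/-- The length `L` of the edge `Γ`. -/
def L (B : Band T) : ℝ := dist (B.p 0) (B.p (B.N + 1))

/-- The minimum of `f i` over `i = 1, …, N`. -/
def minOver (B : Band T) (f : ℕ → ℝ) : ℝ :=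
  (Finset.Icc 1 B.N).inf' (Finset.nonempty_Icc.2 B.one_le_N) f

end Band

end FEMBand

end

/-
Along the edge `Γ` of a band, `U` is piecewise affine in the arc length, whereas `u` has second
derivative `2`. If the jumps of the slope of `U` add up to less than a small multiple of `L`, then
all second differences of `u - U` with a step `m` proportional to `L` are at least `m²` on the
edge. One triangle of `Ω` contains a long part of the edge; since it contains a ball of a fixed
radius, comparing the edge with parallel segments in this triangle gives `L⁵ ≲ |u - U|²`, which
contradicts `L ≥ C_L h^(2α/5)`. Hence the jumps add up to at least a multiple of `L`.

The gradients of `U` on two elements with a common side agree in the direction of that side. The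
sides of `K̃_i` at `p_i` are shared with `K_{i-1}` and `K_i`, and by the maximum angle conditions
the edge direction, up to sign, and the two unit vectors along these sides are within `2 sin(π -
α̃_i)` of each other. So the slope jump at `p_i` is at most `2 sin(π - α̃_i)` times the sum of the
distances of the three gradients to `∇u(p_i)`. Since `∇u` varies by `O(h)` on an element, summing
the squares bounds the jumps by the error on the band, up to `O(h^α)`, and the Cauchy-Schwarz
inequality turns the sum of the jumps into `L² / N`.
-/

namespace FEMBand

section ConvexHull

variable {E : Type*} [NormedAddCommGroup E] [NormedSpace ℝ E] [FiniteDimensional ℝ E]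

lemma addHaar_convexHull_eq_zero [MeasurableSpace E] [BorelSpace E] (μ : Measure E)
    [μ.IsAddHaarMeasure] {s : Finset E} (hs : s.card ≤ Module.finrank ℝ E) :
    μ (convexHull ℝ (s : Set E)) = 0 := by
  classical
  rcases s.eq_empty_or_nonempty with rfl | hne
  · simp
  have hcard : s.card = (s.card - 1) + 1 := by have := hne.card_pos; omega
  have hrank : Module.finrank ℝ (vectorSpan ℝ (s : Set E)) ≤ s.card - 1 := by
    have h := finrank_vectorSpan_image_finset_le ℝ (id : E → E) s hcard
    rwa [Finset.coe_image, image_id] at h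
  have hspan : affineSpan ℝ (s : Set E) ≠ ⊤ := by
    intro h
    rw [← direction_affineSpan, h, AffineSubspace.direction_top, finrank_top] at hrank
    omega
  exact measure_mono_null (convexHull_subset_affineSpan _)
    (Measure.addHaar_affineSubspace μ _ hspan)

lemma interior_convexHull_nonempty {s : Finset E} (hi : AffineIndependent ℝ ((↑) : s → E))
    (hs : s.card = Module.finrank ℝ E + 1) :
    (interior (convexHull ℝ (s : Set E))).Nonempty := by
  refine interior_convexHull_nonempty_iff_affineSpan_eq_top.2 ?_
  simpa only [Subtype.range_coe_subtype, Finset.setOfPred_mem] using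
    hi.affineSpan_eq_top_iff_card_eq_finrank_add_one.2 (by simpa only [Fintype.card_coe] using hs)

end ConvexHull

section Body

lemma convex_body (s : Finset Plane) : Convex ℝ (body s) := convex_convexHull ℝ _

lemma isCompact_body (s : Finset Plane) : IsCompact (body s) :=
  s.finite_toSet.isCompact_convexHull ℝ

lemma isClosed_body (s : Finset Plane) : IsClosed (body s) := (isCompact_body s).isClosed

lemma mem_body_of_mem {s : Finset Plane} {x : Plane} (hx : x ∈ s) : x ∈ body s :=
  subset_convexHull ℝ _ hx

lemma volume_body_eq_zero {s : Finset Plane} (hs : s.card ≤ 2) : volume (body s) = 0 :=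
  addHaar_convexHull_eq_zero volume (by simpa only [finrank_euclideanSpace_fin] using hs)

lemma interior_body_ae_eq (s : Finset Plane) : interior (body s) =ᵐ[volume] body s :=
  interior_ae_eq_of_null_frontier ((convex_body s).addHaar_frontier volume)

end Body

section Triangulation

variable {T : Geometry.SimplicialComplex ℝ Plane} {Ω : Set Plane}

lemma IsTriangulation.finite_elements (hT : IsTriangulation T Ω) : (elements T).Finite :=
  hT.finite.subset fun _ hs => hs.1

lemma IsTriangulation.body_subset_closure (hT : IsTriangulation T Ω) {s : Finset Plane}
    (hs : s ∈ elements T) : body s ⊆ closure Ω :=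
  hT.space_eq ▸ Geometry.SimplicialComplex.convexHull_subset_space hs.1

lemma IsTriangulation.isCompact_closure (hT : IsTriangulation T Ω) : IsCompact (closure Ω) := by
  rw [← hT.space_eq]
  exact hT.finite.isCompact_biUnion fun s _ => isCompact_body s

lemma volume_body_eq_zero_of_notMem_elements {s : Finset Plane} (hs : s ∈ T.faces)
    (hs' : s ∉ elements T) : volume (body s) = 0 := by
  have hcard := (T.indep hs).card_le_finrank_succ
  have hrank := Submodule.finrank_le (vectorSpan ℝ (range ((↑) : s → Plane)))
  have hne : s.card ≠ 3 := fun h => hs' ⟨hs, h⟩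
  rw [finrank_euclideanSpace_fin] at hrank
  rw [Fintype.card_coe] at hcard
  exact volume_body_eq_zero (by omega)

lemma IsTriangulation.closure_eq_biUnion_elements (hT : IsTriangulation T Ω) (hΩ : IsOpen Ω) :
    closure Ω = ⋃ s ∈ elements T, body s := by
  refine Subset.antisymm ?_ (iUnion₂_subset fun s hs => hT.body_subset_closure hs)
  have hclosed : IsClosed (⋃ s ∈ elements T, body s) :=
    hT.finite_elements.isClosed_biUnion fun s _ => isClosed_body s
  refine closure_minimal (fun x hx => ?_) hclosed
  -- Otherwise the simplices of dimension at most one would cover a nonempty open set.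
  by_contra hxE
  have hsub : Ω \ (⋃ s ∈ elements T, body s) ⊆ ⋃ s ∈ T.faces \ elements T, body s := by
    rintro y ⟨hy, hyE⟩
    have hspace : y ∈ T.space := hT.space_eq ▸ subset_closure hy
    obtain ⟨s, hs, hys⟩ := Geometry.SimplicialComplex.mem_space_iff.1 hspace
    exact mem_biUnion (x := s) ⟨hs, fun hse => hyE (mem_biUnion hse hys)⟩ hys
  have hnull : volume (⋃ s ∈ T.faces \ elements T, body s) = 0 :=
    (measure_biUnion_null_iff (hT.finite.subset sdiff_subset).countable).2
      fun s hs => volume_body_eq_zero_of_notMem_elements hs.1 hs.2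
  exact ((hΩ.sdiff hclosed).measure_pos volume ⟨x, hx, hxE⟩).ne' (measure_mono_null hsub hnull)

lemma IsTriangulation.ae_mem_interior_body (hT : IsTriangulation T Ω) (hΩ : IsOpen Ω) :
    ∀ᵐ x : Plane, x ∈ closure Ω → ∃ s ∈ elements T, x ∈ interior (body s) := by
  have hae : ∀ᵐ x : Plane, ∀ s ∈ elements T, x ∈ interior (body s) ↔ x ∈ body s :=
    (ae_ball_iff hT.finite_elements.countable).2 fun s _ => (interior_body_ae_eq s).mem_iff
  filter_upwards [hae] with x hx hxΩ
  rw [hT.closure_eq_biUnion_elements hΩ] at hxΩ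
  obtain ⟨s, hs, hxs⟩ := mem_iUnion₂.1 hxΩ
  exact ⟨s, hs, (hx s hs).2 hxs⟩

lemma IsTriangulation.closure_ae_eq (hT : IsTriangulation T Ω)
    (hΩ : interior (closure Ω) = Ω) : closure Ω =ᵐ[volume] Ω := by
  filter_upwards [hT.ae_mem_interior_body (hΩ ▸ isOpen_interior)] with x hx
  refine propext ⟨fun hxΩ => ?_, fun h => subset_closure h⟩
  obtain ⟨s, hs, hxs⟩ := hx hxΩ
  exact hΩ ▸ interior_mono (hT.body_subset_closure hs) hxs

lemma disjoint_interior_body {s t : Finset Plane} (hs : s ∈ elements T) (ht : t ∈ elements T)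
    (hst : s ≠ t) : Disjoint (interior (body s)) (interior (body t)) := by
  classical
  rw [disjoint_iff_inter_eq_empty]
  by_contra hne
  have hpos := (isOpen_interior.inter isOpen_interior).measure_pos volume
    (nonempty_iff_ne_empty.2 hne)
  have hsub : interior (body s) ∩ interior (body t) ⊆ body (s ∩ t) := by
    refine (inter_subset_inter interior_subset interior_subset).trans ?_
    simpa only [body, Finset.coe_inter] using T.inter_subset_convexHull hs.1 ht.1
  have hcard : (s ∩ t).card ≤ 2 := by
    by_contra hc
    have hinter_left : s ∩ t = s :=
      Finset.eq_of_subset_of_card_le Finset.inter_subset_left (by rw [hs.2]; omega)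
    have hinter_right : s ∩ t = t :=
      Finset.eq_of_subset_of_card_le Finset.inter_subset_right (by rw [ht.2]; omega)
    exact hst (hinter_left.symm.trans hinter_right)
  exact hpos.ne' (measure_mono_null hsub (volume_body_eq_zero hcard))

lemma sum_setIntegral_body_le {f : Plane → ℝ} (hf : ∀ x, 0 ≤ f x) {S : Set Plane}
    (hfS : IntegrableOn f S) {ι : Type*} {I : Finset ι} {k : ι → Finset Plane}
    (hk : InjOn k I) (hmem : ∀ i ∈ I, k i ∈ elements T) (hsub : ∀ i ∈ I, body (k i) ⊆ S) :
    ∑ i ∈ I, ∫ x in body (k i), f x ≤ ∫ x in S, f x := by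
  calc ∑ i ∈ I, ∫ x in body (k i), f x
      = ∑ i ∈ I, ∫ x in interior (body (k i)), f x :=
        Finset.sum_congr rfl fun i _ => (setIntegral_congr_set (interior_body_ae_eq (k i))).symm
    _ = ∫ x in ⋃ i ∈ I, interior (body (k i)), f x :=
        (integral_biUnion_finset I (fun _ _ => isOpen_interior.measurableSet)
          (fun i hi j hj hij =>
            disjoint_interior_body (hmem i hi) (hmem j hj) (hk.ne hi hj hij))
          (fun i hi => hfS.mono_set (interior_subset.trans (hsub i hi)))).symm
    _ ≤ ∫ x in S, f x :=
        setIntegral_mono_set hfS (Filter.Eventually.of_forall hf)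
          (iUnion₂_subset fun i hi => interior_subset.trans (hsub i hi)).eventuallyLE

end Triangulation

section Line

lemma enorm_sub_le_lintegral_deriv {φ : ℝ → ℝ} {a b : ℝ} (hab : a ≤ b)
    (hc : ContinuousOn φ (Icc a b)) {C : Set ℝ} (hC : C.Countable)
    (hd : ∀ t ∈ Ioo a b \ C, DifferentiableAt ℝ φ t) :
    ‖φ b - φ a‖ₑ ≤ ∫⁻ t in Icc a b, ‖deriv φ t‖ₑ := by
  rcases eq_or_ne (∫⁻ t in Icc a b, ‖deriv φ t‖ₑ) ⊤ with htop | hfin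
  · exact htop ▸ le_top
  have hint : IntegrableOn (deriv φ) (Icc a b) :=
    ⟨(measurable_deriv φ).aestronglyMeasurable, lt_top_iff_ne_top.2 hfin⟩
  have hftc := integral_eq_of_hasDerivAt_off_countable φ (deriv φ) hC
    (by rwa [uIcc_of_le hab])
    (fun t ht => (hd t (by simpa only [min_eq_left hab, max_eq_right hab] using ht)).hasDerivAt)
    ((intervalIntegrable_iff_integrableOn_Icc_of_le hab).2 hint)
  rw [← hftc, intervalIntegral.integral_of_le hab]
  exact (enorm_integral_le_lintegral_enorm _).trans (lintegral_mono_set Ioc_subset_Icc_self)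

lemma hasDerivAt_add_smul {E : Type*} [NormedAddCommGroup E] [NormedSpace ℝ E] (A d : E) (t : ℝ) :
    HasDerivAt (fun t : ℝ => A + t • d) d t := by
  simpa only [id, one_smul] using ((hasDerivAt_id t).smul_const d).const_add A

lemma enorm_sub_le_lintegral_gradient {E : Type*} [NormedAddCommGroup E] [InnerProductSpace ℝ E]
    [CompleteSpace E] {v : E → ℝ} {A d : E} {a b : ℝ} (hab : a ≤ b)
    (hc : ContinuousOn (fun t : ℝ => v (A + t • d)) (Icc a b)) {C : Set ℝ} (hC : C.Countable)
    (hd : ∀ t ∈ Ioo a b \ C, DifferentiableAt ℝ (fun t : ℝ => v (A + t • d)) t)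
    (hv : ∀ᵐ t, t ∈ Icc a b → DifferentiableAt ℝ v (A + t • d)) :
    ‖v (A + b • d) - v (A + a • d)‖ₑ
      ≤ ‖d‖ₑ * ∫⁻ t in Icc a b, ‖gradient v (A + t • d)‖ₑ := by
  refine (enorm_sub_le_lintegral_deriv hab hc hC hd).trans ?_
  rw [← lintegral_const_mul' _ _ enorm_ne_top]
  refine lintegral_mono_ae ?_
  filter_upwards [ae_restrict_of_ae hv, ae_restrict_mem measurableSet_Icc] with t hvt ht
  have hchain : deriv (fun t : ℝ => v (A + t • d)) t = inner ℝ (gradient v (A + t • d)) d := by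
    rw [← InnerProductSpace.toDual_apply_apply]
    exact ((hvt ht).hasGradientAt.hasFDerivAt.comp_hasDerivAt t (hasDerivAt_add_smul A d t)).deriv
  rw [hchain, mul_comm, ← ofReal_norm, ← ofReal_norm, ← ofReal_norm,
    ← ENNReal.ofReal_mul (norm_nonneg _)]
  exact ENNReal.ofReal_le_ofReal (norm_inner_le_norm _ _)

variable {E : Type*} [NormedAddCommGroup E] [NormedSpace ℝ E]

lemma exists_eq_Icc_of_line_inter {P : Set E} (hconv : Convex ℝ P) (hclosed : IsClosed P)
    {A d : E} {a b : ℝ} (hne : ({t : ℝ | A + t • d ∈ P} ∩ Icc a b).Nonempty) :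
    ∃ c e : ℝ, c ≤ e ∧ {t : ℝ | A + t • d ∈ P} ∩ Icc a b = Icc c e := by
  have hline : {t : ℝ | A + t • d ∈ P} = AffineMap.lineMap A (A + d) ⁻¹' P := by
    ext t
    simp only [mem_ofPred_eq, mem_preimage, AffineMap.lineMap_apply, vsub_eq_sub, vadd_eq_add,
      add_sub_cancel_left, add_comm]
  have hconv' : Convex ℝ ({t : ℝ | A + t • d ∈ P} ∩ Icc a b) := by
    rw [hline]
    exact (hconv.affine_preimage (AffineMap.lineMap A (A + d) : ℝ →ᵃ[ℝ] E)).inter (convex_Icc a b)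
  have hcomp : IsCompact ({t : ℝ | A + t • d ∈ P} ∩ Icc a b) :=
    isCompact_Icc.inter_left (hclosed.preimage (by fun_prop))
  have hIcc := eq_Icc_of_connected_compact ⟨hne, hconv'.isPreconnected⟩ hcomp
  exact ⟨_, _, nonempty_Icc.1 (hIcc ▸ hne), hIcc⟩

lemma exists_countable_differentiableAt_line {F ι : Type*} [NormedAddCommGroup F]
    [NormedSpace ℝ F] {v : E → F} {I : Set ι} (hI : I.Countable) {P : ι → Set E}
    (hconv : ∀ i ∈ I, Convex ℝ (P i)) (hclosed : ∀ i ∈ I, IsClosed (P i))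
    (hv : ∀ i ∈ I, DifferentiableOn ℝ v (P i)) {A d : E} {a b : ℝ}
    (hcover : ∀ t ∈ Icc a b, A + t • d ∈ ⋃ i ∈ I, P i) :
    ∃ C : Set ℝ, C.Countable ∧
      ∀ t ∈ Ioo a b \ C, DifferentiableAt ℝ (fun t : ℝ => v (A + t • d)) t := by
  set J : ι → Set ℝ := fun i => {t | A + t • d ∈ P i} ∩ Icc a b
  refine ⟨⋃ i ∈ I, frontier (J i), hI.biUnion fun i hi => ?_, ?_⟩
  · rcases (J i).eq_empty_or_nonempty with hempty | hne
    · simp only [hempty, frontier_empty, countable_empty]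
    · obtain ⟨c, e, hce, hIcc⟩ := exists_eq_Icc_of_line_inter (hconv i hi) (hclosed i hi) hne
      rw [show J i = Icc c e from hIcc, frontier_Icc hce]
      exact (Set.toFinite _).countable
  · rintro t ⟨ht, htC⟩
    obtain ⟨i, hi, hti⟩ := mem_iUnion₂.1 (hcover t (Ioo_subset_Icc_self ht))
    have hint : t ∈ interior (J i) := by
      by_contra h
      exact htC (mem_biUnion hi ⟨subset_closure ⟨hti, Ioo_subset_Icc_self ht⟩, h⟩)
    have hwithin : DifferentiableWithinAt ℝ (fun t : ℝ => v (A + t • d)) (J i) t :=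
      (hv i hi _ hti).comp t (hasDerivAt_add_smul A d t).differentiableAt.differentiableWithinAt
        fun τ hτ => hτ.1
    exact hwithin.differentiableAt (mem_interior_iff_mem_nhds.1 hint)

lemma exists_subsegment_mem {ι : Type*} {I : Finset ι} (hI : I.Nonempty) {P : ι → Set E}
    (hconv : ∀ i ∈ I, Convex ℝ (P i)) (hclosed : ∀ i ∈ I, IsClosed (P i)) {A d : E} {L : ℝ}
    (hL : 0 < L) (hcover : ∀ t ∈ Icc 0 L, A + t • d ∈ ⋃ i ∈ I, P i) :
    ∃ i ∈ I, ∃ a, 0 ≤ a ∧ a + L / I.card ≤ L ∧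
      A + a • d ∈ P i ∧ A + (a + L / I.card) • d ∈ P i := by
  have hcard : (0 : ℝ) < I.card := by exact_mod_cast hI.card_pos
  set J : ι → Set ℝ := fun i => {t | A + t • d ∈ P i} ∩ Icc 0 L
  have hsub : Icc 0 L ⊆ ⋃ i ∈ I, J i := fun t ht => by
    obtain ⟨i, hi, hti⟩ := mem_iUnion₂.1 (hcover t ht)
    exact mem_biUnion hi ⟨hti, ht⟩
  have hsum : ∑ _i ∈ I, L / I.card ≤ ∑ i ∈ I, volume.real (J i) := by
    calc ∑ _i ∈ I, L / I.card = volume.real (Icc 0 L) := by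
          rw [Finset.sum_const, nsmul_eq_mul, mul_div_cancel₀ _ hcard.ne',
            Real.volume_real_Icc_of_le hL.le, sub_zero]
      _ ≤ volume.real (⋃ i ∈ I, J i) := by
          have hbdd : ⋃ i ∈ I, J i ⊆ Icc 0 L := iUnion₂_subset fun i _ => inter_subset_right
          exact measureReal_mono hsub (measure_ne_top_of_subset hbdd isCompact_Icc.measure_ne_top)
      _ ≤ ∑ i ∈ I, volume.real (J i) := measureReal_biUnion_finset_le _ _
  obtain ⟨i, hi, hle⟩ := Finset.exists_le_of_sum_le hI hsum
  have hne : (J i).Nonempty := by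
    by_contra h
    rw [not_nonempty_iff_eq_empty.1 h, measureReal_empty] at hle
    exact (div_pos hL hcard).not_ge hle
  obtain ⟨c, e, hce, hIcc : J i = Icc c e⟩ :=
    exists_eq_Icc_of_line_inter (hconv i hi) (hclosed i hi) hne
  rw [hIcc, Real.volume_real_Icc_of_le hce] at hle
  have hc : c ∈ J i := hIcc ▸ left_mem_Icc.2 hce
  have hc' : c + L / I.card ∈ J i :=
    hIcc ▸ ⟨le_add_of_nonneg_right (div_pos hL hcard).le, by linarith⟩
  exact ⟨i, hi, c, hc.2.1, hc'.2.2, hc.1, hc'.1⟩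

end Line

section Gradient

variable {E : Type*} [NormedAddCommGroup E] [InnerProductSpace ℝ E] [CompleteSpace E]

lemma measurable_gradient [MeasurableSpace E] [BorelSpace E] (v : E → ℝ) :
    Measurable (gradient v) :=
  (InnerProductSpace.toDual ℝ E).symm.continuous.measurable.comp (measurable_fderiv ℝ v)

/-- A function which is admissible for one-dimensional arguments in `S`: it is continuous, along
every segment in `S` it is differentiable off a countable set (so that it is recovered from its
derivative), and its classical gradient exists almost everywhere and is square integrable. -/
structure SegmentwiseH1On [MeasureSpace E] (v : E → ℝ) (S : Set E) : Prop where
  continuousOn : ContinuousOn v S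
  differentiableAt_line : ∀ (A d : E) (a b : ℝ), (∀ t ∈ Icc a b, A + t • d ∈ S) →
    ∃ C : Set ℝ, C.Countable ∧
      ∀ t ∈ Ioo a b \ C, DifferentiableAt ℝ (fun t : ℝ => v (A + t • d)) t
  ae_differentiableAt : ∀ᵐ x, x ∈ S → DifferentiableAt ℝ v x
  integrableOn_sq : IntegrableOn (fun x => ‖gradient v x‖ ^ 2) S

namespace SegmentwiseH1On

variable [MeasureSpace E] {v : E → ℝ} {S S' : Set E}

lemma mono (h : SegmentwiseH1On v S) (hS : S' ⊆ S) : SegmentwiseH1On v S' where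
  continuousOn := h.continuousOn.mono hS
  differentiableAt_line A d a b hΓ := h.differentiableAt_line A d a b fun t ht => hS (hΓ t ht)
  ae_differentiableAt := h.ae_differentiableAt.mono fun _ hx hxS => hx (hS hxS)
  integrableOn_sq := h.integrableOn_sq.mono_set hS

lemma enorm_sub_le_lintegral (h : SegmentwiseH1On v S) {A d : E} {a b : ℝ} (hab : a ≤ b)
    (hΓ : ∀ t ∈ Icc a b, A + t • d ∈ S)
    (hv : ∀ᵐ t, t ∈ Icc a b → DifferentiableAt ℝ v (A + t • d)) :
    ‖v (A + b • d) - v (A + a • d)‖ₑ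
      ≤ ‖d‖ₑ * ∫⁻ t in Icc a b, ‖gradient v (A + t • d)‖ₑ := by
  obtain ⟨C, hC, hd⟩ := h.differentiableAt_line A d a b hΓ
  exact enorm_sub_le_lintegral_gradient hab
    (h.continuousOn.comp (by fun_prop) hΓ) hC hd hv

lemma lintegral_sq (h : SegmentwiseH1On v S) :
    ∫⁻ x in S, ‖gradient v x‖ₑ ^ 2 = ENNReal.ofReal (∫ x in S, ‖gradient v x‖ ^ 2) := by
  rw [ofReal_integral_eq_lintegral_ofReal h.integrableOn_sq
    (Filter.Eventually.of_forall fun x => by positivity)]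
  refine lintegral_congr fun x => ?_
  rw [ENNReal.ofReal_pow (norm_nonneg _), ofReal_norm]

end SegmentwiseH1On

lemma h1Seminorm_nonneg (S : Set Plane) (v : Plane → ℝ) : 0 ≤ h1Seminorm S v := Real.sqrt_nonneg _

lemma h1Seminorm_sq (S : Set Plane) (v : Plane → ℝ) :
    h1Seminorm S v ^ 2 = ∫ x in S, ‖gradient v x‖ ^ 2 :=
  Real.sq_sqrt (integral_nonneg fun _ => by positivity)

lemma SegmentwiseH1On.h1Seminorm_sq_mono {v : Plane → ℝ} {S S' : Set Plane}
    (h : SegmentwiseH1On v S) (hS : S' ⊆ S) : h1Seminorm S' v ^ 2 ≤ h1Seminorm S v ^ 2 := by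
  rw [h1Seminorm_sq, h1Seminorm_sq]
  exact setIntegral_mono_set h.integrableOn_sq
    (Filter.Eventually.of_forall fun _ => by positivity) hS.eventuallyLE

end Gradient

section SecondDifference

lemma sq_lintegral_le {α : Type*} [MeasurableSpace α] {μ : Measure α} {f : α → ENNReal}
    (hf : AEMeasurable f μ) : (∫⁻ x, f x ∂μ) ^ 2 ≤ μ univ * ∫⁻ x, f x ^ 2 ∂μ := by
  have hhalf : ∀ a : ENNReal, (a ^ (1 / 2 : ℝ)) ^ 2 = a := fun a => by
    rw [← ENNReal.rpow_natCast, ← ENNReal.rpow_mul]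
    norm_num
  have hholder := ENNReal.lintegral_mul_le_Lp_mul_Lq μ Real.HolderConjugate.two_two
    aemeasurable_one hf
  simp only [Pi.mul_apply, one_mul, ENNReal.rpow_two, one_pow, lintegral_one]
    at hholder
  calc (∫⁻ x, f x ∂μ) ^ 2
      ≤ (μ univ ^ (1 / 2 : ℝ) * (∫⁻ x, f x ^ 2 ∂μ) ^ (1 / 2 : ℝ)) ^ 2 := by gcongr
    _ = μ univ * ∫⁻ x, f x ^ 2 ∂μ := by rw [mul_pow, hhalf, hhalf]

lemma exists_mem_mul_le_setLIntegral {α : Type*} [MeasurableSpace α] {μ : Measure α} {s : Set α}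
    (hs : MeasurableSet s) (hμ : μ s ≠ 0) (hμ' : μ s ≠ ⊤) {f : α → ENNReal}
    (hf : AEMeasurable f (μ.restrict s)) {P : α → Prop} (hP : ∀ᵐ x ∂μ, x ∈ s → P x) :
    ∃ x ∈ s, P x ∧ μ s * f x ≤ ∫⁻ y in s, f y ∂μ := by
  have hnull : μ.restrict s {x | ¬ (x ∈ s ∧ P x)} = 0 := by
    refine ae_iff.1 ?_
    filter_upwards [ae_restrict_mem hs, ae_restrict_of_ae hP] with x hx hPx using ⟨hx, hPx hx⟩
  have : IsFiniteMeasure (μ.restrict s) := isFiniteMeasure_restrict.2 hμ'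
  obtain ⟨x, hx, hle⟩ := exists_notMem_null_le_laverage
    (fun h => hμ (Measure.restrict_eq_zero.1 h)) hf hnull
  obtain ⟨hxs, hPx⟩ := not_not.1 hx
  refine ⟨x, hxs, hPx, ?_⟩
  rw [setLAverage_eq] at hle
  exact (mul_le_mul_right hle _).trans ENNReal.mul_div_le

lemma setLIntegral_comp_add_right_le (f : ℝ → ENNReal) {s t : Set ℝ} {c : ℝ}
    (hst : ∀ x ∈ s, x + c ∈ t) : ∫⁻ x in s, f (x + c) ≤ ∫⁻ x in t, f x :=
  calc ∫⁻ x in s, f (x + c) ≤ ∫⁻ x in (· + c) ⁻¹' t, f (x + c) := lintegral_mono_set hst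
    _ = ∫⁻ x in t, f x := (measurePreserving_add_right volume c).setLIntegral_comp_preimage_emb
        (measurableEmbedding_addRight c) f t

lemma enorm_second_difference_le {E : Type*} [NormedAddCommGroup E] (a b c a' b' c' : E) :
    ‖c - b - (b - a)‖ₑ ≤ ‖c' - b'‖ₑ + ‖b' - a'‖ₑ
      + (‖c' - c‖ₑ + 2 * ‖b' - b‖ₑ + ‖a' - a‖ₑ) := by
  calc ‖c - b - (b - a)‖ₑ
      = ‖(c' - b') - (b' - a') - ((c' - c) - ((b' - b) + (b' - b)) + (a' - a))‖ₑ := by abel_nf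
    _ ≤ ‖c' - b'‖ₑ + ‖b' - a'‖ₑ + (‖c' - c‖ₑ + (‖b' - b‖ₑ + ‖b' - b‖ₑ) + ‖a' - a‖ₑ) := by
        refine enorm_sub_le.trans (add_le_add enorm_sub_le ?_)
        refine (enorm_add_le _ _).trans (add_le_add ?_ le_rfl)
        exact enorm_sub_le.trans (add_le_add le_rfl (enorm_add_le _ _))
    _ = _ := by rw [← two_mul]

lemma exists_mem_mul_add_le_setLIntegral {f : ℝ → ENNReal} (hf : Measurable f) {m : ℝ}
    (hm : 0 < m) {P : ℝ → Prop} (hP : ∀ᵐ t, t ∈ Icc 0 (3 * m) → P t) :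
    ∃ t ∈ Icc 0 m, (P t ∧ P (t + m) ∧ P (t + m + m)) ∧
      ENNReal.ofReal m * (f (t + m + m) + 2 * f (t + m) + f t)
        ≤ 4 * ∫⁻ s in Icc 0 (3 * m), f s := by
  have hshift : ∀ c ∈ Icc 0 (2 * m), ∀ t ∈ Icc 0 m, t + c ∈ Icc 0 (3 * m) :=
    fun c hc t ht => ⟨by linarith [hc.1, ht.1], by linarith [hc.2, ht.2]⟩
  have hle : ∀ c ∈ Icc 0 (2 * m),
      ∫⁻ t in Icc 0 m, f (t + c) ≤ ∫⁻ s in Icc 0 (3 * m), f s :=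
    fun c hc => setLIntegral_comp_add_right_le f (hshift c hc)
  have hPc : ∀ c ∈ Icc 0 (2 * m), ∀ᵐ t, t ∈ Icc 0 m → P (t + c) := fun c hc => by
    filter_upwards [(measurePreserving_add_right volume c).quasiMeasurePreserving.ae hP]
      with t ht htm using ht (hshift c hc t htm)
  have h₀ : (0 : ℝ) ∈ Icc 0 (2 * m) := ⟨le_rfl, by positivity⟩
  have h₁ : m ∈ Icc 0 (2 * m) := ⟨hm.le, by linarith⟩
  have h₂ : m + m ∈ Icc 0 (2 * m) := ⟨by positivity, by linarith⟩
  have hae : ∀ᵐ t, t ∈ Icc 0 m → P t ∧ P (t + m) ∧ P (t + m + m) := by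
    filter_upwards [hPc 0 h₀, hPc m h₁, hPc (m + m) h₂] with t ht₀ ht₁ ht₂ ht
    exact ⟨add_zero t ▸ ht₀ ht, ht₁ ht, add_assoc t m m ▸ ht₂ ht⟩
  obtain ⟨t, ht, hPt, hmean⟩ := exists_mem_mul_le_setLIntegral (s := Icc 0 m) measurableSet_Icc
    (by simpa using hm) (by simp) (f := fun t => f (t + (m + m)) + 2 * f (t + m) + f (t + 0))
    (by fun_prop) hae
  refine ⟨t, ht, hPt, ?_⟩
  rw [Real.volume_Icc, sub_zero] at hmean
  simp only [add_zero, ← add_assoc] at hmean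
  refine hmean.trans ?_
  calc ∫⁻ t in Icc 0 m, (f (t + m + m) + 2 * f (t + m) + f t)
      = (∫⁻ t in Icc 0 m, f (t + (m + m))) + 2 * (∫⁻ t in Icc 0 m, f (t + m))
          + ∫⁻ t in Icc 0 m, f (t + 0) := by
        simp only [add_zero, ← add_assoc]
        rw [lintegral_add_right _ hf, lintegral_add_left (by fun_prop),
          lintegral_const_mul _ (by fun_prop)]
    _ ≤ (∫⁻ s in Icc 0 (3 * m), f s) + 2 * (∫⁻ s in Icc 0 (3 * m), f s)
          + ∫⁻ s in Icc 0 (3 * m), f s :=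
        add_le_add (add_le_add (hle _ h₂) (mul_le_mul_right (hle _ h₁) 2)) (hle _ h₀)
    _ = 4 * ∫⁻ s in Icc 0 (3 * m), f s := by ring

-- In a row with small horizontal variation the second differences are small, so that they can be
-- large on the bottom edge only if the vertical variation is large.
lemma mul_le_setLIntegral_of_second_difference {V : ℝ × ℝ → ℝ} {H : ℝ × ℝ → ENNReal}
    (hH : Measurable H) {m σ : ℝ} (hm : 0 < m) (hσ : 0 < σ) {D κ : ENNReal}
    (hD : D * ENNReal.ofReal σ ≤ ENNReal.ofReal m)
    (hvert : ∀ᵐ t, t ∈ Icc 0 (3 * m) → ∀ y ∈ Icc 0 σ,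
      ‖V (t, y) - V (t, 0)‖ₑ ≤ D * ∫⁻ s in Icc 0 σ, H (t, s))
    (hhor : ∀ᵐ y, y ∈ Icc 0 σ → ∀ t ∈ Icc 0 (2 * m),
      ‖V (t + m, y) - V (t, y)‖ₑ ≤ ∫⁻ s in Icc 0 (3 * m), H (s, y))
    (hκ : ∀ t ∈ Icc 0 m,
      κ ≤ ‖V (t + m + m, 0) - V (t + m, 0) - (V (t + m, 0) - V (t, 0))‖ₑ) :
    κ * ENNReal.ofReal σ ≤ 6 * ∫⁻ z in Icc 0 (3 * m) ×ˢ Icc 0 σ, H z := by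
  set row : ℝ → ENNReal := fun y => ∫⁻ s in Icc 0 (3 * m), H (s, y)
  set col : ℝ → ENNReal := fun t => ∫⁻ s in Icc 0 σ, H (t, s)
  set I := ∫⁻ z in Icc 0 (3 * m) ×ˢ Icc 0 σ, H z with hI
  have hcolm : Measurable col := hH.lintegral_prod_right'
  have hrowI : ∫⁻ y in Icc 0 σ, row y = I := by
    rw [hI, Measure.volume_eq_prod, ← Measure.prod_restrict,
      lintegral_prod_symm' _ hH]
  have hcolI : ∫⁻ t in Icc 0 (3 * m), col t = I := by
    rw [hI, Measure.volume_eq_prod, ← Measure.prod_restrict, lintegral_prod _ hH.aemeasurable]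
  obtain ⟨y, hy, hhor, hyI⟩ : ∃ y ∈ Icc 0 σ, (∀ t ∈ Icc 0 (2 * m),
      ‖V (t + m, y) - V (t, y)‖ₑ ≤ row y) ∧ ENNReal.ofReal σ * row y ≤ I := by
    have h := exists_mem_mul_le_setLIntegral (s := Icc 0 σ) measurableSet_Icc
      (by simpa using hσ) (by simp) (f := row) hH.lintegral_prod_left'.aemeasurable hhor
    simpa only [Real.volume_Icc, sub_zero, hrowI] using h
  obtain ⟨t, ht, ⟨hvert₀, hvert₁, hvert₂⟩, htI⟩ :=
    exists_mem_mul_add_le_setLIntegral hcolm hm hvert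
  rw [hcolI] at htI
  have hκI : κ ≤ 2 * row y + D * (col (t + m + m) + 2 * col (t + m) + col t) :=
    calc κ ≤ _ := hκ t ht
      _ ≤ _ := enorm_second_difference_le _ _ _ (V (t, y)) (V (t + m, y)) (V (t + m + m, y))
      _ ≤ row y + row y + (D * col (t + m + m) + 2 * (D * col (t + m)) + D * col t) := by
        gcongr
        exacts [hhor _ ⟨by linarith [ht.1], by linarith [ht.2]⟩,
          hhor _ ⟨ht.1, by linarith [ht.2]⟩, hvert₂ _ hy, hvert₁ _ hy, hvert₀ _ hy]
      _ = _ := by ring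
  have hm₀ : ENNReal.ofReal m ≠ 0 := by simpa using hm
  refine (ENNReal.mul_le_mul_iff_right hm₀ ENNReal.ofReal_ne_top).1 ?_
  calc ENNReal.ofReal m * (κ * ENNReal.ofReal σ)
      ≤ ENNReal.ofReal m * ((2 * row y + D * (col (t + m + m) + 2 * col (t + m) + col t))
          * ENNReal.ofReal σ) := by gcongr
    _ = ENNReal.ofReal m * (2 * (ENNReal.ofReal σ * row y)) + (D * ENNReal.ofReal σ)
          * (ENNReal.ofReal m * (col (t + m + m) + 2 * col (t + m) + col t)) := by ring
    _ ≤ ENNReal.ofReal m * (2 * I) + ENNReal.ofReal m * (4 * I) := by gcongr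
    _ = ENNReal.ofReal m * (6 * I) := by ring

lemma sq_mul_le_setLIntegral_sq_of_second_difference {V : ℝ × ℝ → ℝ} {H : ℝ × ℝ → ENNReal}
    (hH : Measurable H) {m σ : ℝ} (hm : 0 < m) (hσ : 0 < σ) {D κ : ENNReal}
    (hD : D * ENNReal.ofReal σ ≤ ENNReal.ofReal m)
    (hvert : ∀ᵐ t, t ∈ Icc 0 (3 * m) → ∀ y ∈ Icc 0 σ,
      ‖V (t, y) - V (t, 0)‖ₑ ≤ D * ∫⁻ s in Icc 0 σ, H (t, s))
    (hhor : ∀ᵐ y, y ∈ Icc 0 σ → ∀ t ∈ Icc 0 (2 * m),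
      ‖V (t + m, y) - V (t, y)‖ₑ ≤ ∫⁻ s in Icc 0 (3 * m), H (s, y))
    (hκ : ∀ t ∈ Icc 0 m,
      κ ≤ ‖V (t + m + m, 0) - V (t + m, 0) - (V (t + m, 0) - V (t, 0))‖ₑ) :
    κ ^ 2 * ENNReal.ofReal σ
      ≤ 108 * ENNReal.ofReal m * ∫⁻ z in Icc 0 (3 * m) ×ˢ Icc 0 σ, H z ^ 2 := by
  set Q := ∫⁻ z in Icc 0 (3 * m) ×ˢ Icc 0 σ, H z ^ 2
  have hvol : volume (Icc 0 (3 * m) ×ˢ Icc 0 σ : Set (ℝ × ℝ))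
      = 3 * ENNReal.ofReal m * ENNReal.ofReal σ := by
    rw [Measure.volume_eq_prod, Measure.prod_prod, Real.volume_Icc, Real.volume_Icc, sub_zero,
      sub_zero, ENNReal.ofReal_mul (by norm_num), ENNReal.ofReal_ofNat]
  have hσ₀ : ENNReal.ofReal σ ≠ 0 := by simpa using hσ
  refine (ENNReal.mul_le_mul_iff_right hσ₀ ENNReal.ofReal_ne_top).1 ?_
  calc ENNReal.ofReal σ * (κ ^ 2 * ENNReal.ofReal σ) = (κ * ENNReal.ofReal σ) ^ 2 := by ring
    _ ≤ (6 * ∫⁻ z in Icc 0 (3 * m) ×ˢ Icc 0 σ, H z) ^ 2 :=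
        pow_le_pow_left'
          (mul_le_setLIntegral_of_second_difference hH hm hσ hD hvert hhor hκ) 2
    _ ≤ 36 * (3 * ENNReal.ofReal m * ENNReal.ofReal σ * Q) := by
        rw [mul_pow, ← hvol, ← Measure.restrict_apply_univ]
        gcongr
        · norm_num
        · exact sq_lintegral_le hH.aemeasurable
    _ = ENNReal.ofReal σ * (108 * ENNReal.ofReal m * Q) := by ring

end SecondDifference

section ObliqueCoordinates

/-- The two-dimensional cross product `x ∧ y`, the signed area of the parallelogram spanned by `x`
and `y`. -/
def cross (x y : Plane) : ℝ := x 0 * y 1 - x 1 * y 0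

/-- The point of the plane with coordinates `z` with respect to the origin `A` and the axes
`g`, `d`. -/
def obliqueCoord (A g d : Plane) (z : ℝ × ℝ) : Plane := A + z.1 • g + z.2 • d

variable {A g d : Plane}

lemma cross_swap (x y : Plane) : cross y x = -cross x y := by
  simp only [cross]
  ring

lemma inner_plane (x y : Plane) : inner ℝ x y = x 0 * y 0 + x 1 * y 1 := by
  simp only [PiLp.inner_apply, Fin.sum_univ_two, RCLike.inner_apply, conj_trivial, mul_comm]

lemma norm_sq_mul_inner (g a b : Plane) :
    ‖g‖ ^ 2 * inner ℝ a b = inner ℝ g a * inner ℝ g b + cross g a * cross g b := by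
  rw [← real_inner_self_eq_norm_sq]
  simp only [inner_plane, cross]
  ring

lemma continuous_obliqueCoord (A g d : Plane) : Continuous (obliqueCoord A g d) := by
  unfold obliqueCoord
  fun_prop

lemma obliqueCoord_swap (A g d : Plane) (t y : ℝ) :
    obliqueCoord A d g (y, t) = obliqueCoord A g d (t, y) :=
  add_right_comm _ _ _

lemma map_obliqueCoord (A : Plane) (hδ : cross g d ≠ 0) :
    Measure.map (obliqueCoord A g d) volume
      = ENNReal.ofReal |(cross g d)⁻¹| • (volume : Measure Plane) := by
  set M : Matrix (Fin 2) (Fin 2) ℝ := !![g 0, d 0; g 1, d 1] with hM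
  have hdet : M.det = cross g d := by
    rw [hM, Matrix.det_fin_two_of, cross]
    ring
  have hcomp : obliqueCoord A g d = (fun x => A + x) ∘ WithLp.toLp 2 ∘ Matrix.toLin' M ∘
      (MeasurableEquiv.finTwoArrow (α := ℝ)).symm := by
    funext z
    ext i
    fin_cases i <;>
      simp [obliqueCoord, hM, MeasurableEquiv.finTwoArrow, MeasurableEquiv.piFinTwo] <;> ring
  have hM_meas : Measurable (Matrix.toLin' M) :=
    (LinearMap.continuous_of_finiteDimensional _).measurable
  have htoLp := PiLp.volume_preserving_toLp (Fin 2)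
  have harrow : Measurable (MeasurableEquiv.finTwoArrow (α := ℝ)).symm :=
    MeasurableEquiv.measurable _
  rw [hcomp,
    ← Measure.map_map (measurable_const_add A) (htoLp.measurable.comp (hM_meas.comp harrow)),
    ← Measure.map_map htoLp.measurable (hM_meas.comp harrow), ← Measure.map_map hM_meas harrow,
    (volume_preserving_finTwoArrow ℝ).symm.map_eq,
    Real.map_matrix_volume_pi_eq_smul_volume_pi (by rwa [hdet]), Measure.map_smul, htoLp.map_eq,
    Measure.map_smul, (measurePreserving_add_left volume A).map_eq, hdet]

lemma setLIntegral_comp_obliqueCoord_le (hδ : cross g d ≠ 0) {f : Plane → ENNReal}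
    (hf : Measurable f) {R : Set (ℝ × ℝ)} {S : Set Plane} (hS : MeasurableSet S)
    (hRS : MapsTo (obliqueCoord A g d) R S) :
    ∫⁻ z in R, f (obliqueCoord A g d z)
      ≤ ENNReal.ofReal |(cross g d)⁻¹| * ∫⁻ x in S, f x :=
  calc ∫⁻ z in R, f (obliqueCoord A g d z)
      ≤ ∫⁻ z in obliqueCoord A g d ⁻¹' S, f (obliqueCoord A g d z) := lintegral_mono_set hRS
    _ = ENNReal.ofReal |(cross g d)⁻¹| * ∫⁻ x in S, f x := by
        rw [← setLIntegral_map hS hf (continuous_obliqueCoord A g d).measurable,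
          map_obliqueCoord A hδ, setLIntegral_smul_measure, smul_eq_mul]

lemma ae_obliqueCoord (A : Plane) (hδ : cross g d ≠ 0) {P : Plane → Prop} (hP : ∀ᵐ x, P x) :
    ∀ᵐ z : ℝ × ℝ, P (obliqueCoord A g d z) := by
  refine ae_of_ae_map (continuous_obliqueCoord A g d).aemeasurable ?_
  rw [map_obliqueCoord A hδ]
  exact Measure.ae_smul_measure hP _

lemma SegmentwiseH1On.ae_enorm_sub_le {v : Plane → ℝ} {S : Set Plane} (hv : SegmentwiseH1On v S)
    (hδ : cross g d ≠ 0) {a b : ℝ}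
    (hmem : ∀ t ∈ Icc 0 a, ∀ y ∈ Icc 0 b, obliqueCoord A g d (t, y) ∈ S) :
    ∀ᵐ t, t ∈ Icc 0 a → ∀ y₁ ∈ Icc 0 b, ∀ y₂ ∈ Icc 0 b, y₁ ≤ y₂ →
      ‖v (obliqueCoord A g d (t, y₂)) - v (obliqueCoord A g d (t, y₁))‖ₑ
        ≤ ‖d‖ₑ * ∫⁻ y in Icc 0 b, ‖gradient v (obliqueCoord A g d (t, y))‖ₑ := by
  have hdiff := ae_obliqueCoord A hδ hv.ae_differentiableAt
  rw [Measure.volume_eq_prod] at hdiff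
  filter_upwards [Measure.ae_ae_of_ae_prod hdiff] with t ht hta y₁ hy₁ y₂ hy₂ hy
  have hmem' : ∀ y ∈ Icc y₁ y₂, A + t • g + y • d ∈ S := fun y hy =>
    hmem t hta y ⟨hy₁.1.trans hy.1, hy.2.trans hy₂.2⟩
  refine (hv.enorm_sub_le_lintegral hy hmem' ?_).trans ?_
  · filter_upwards [ht] with y hyd hyI using hyd (hmem' y hyI)
  · gcongr
    exacts [hy₁.1, hy₂.2, le_rfl]

lemma SegmentwiseH1On.sq_le_h1Seminorm_of_second_difference_rectangle {v : Plane → ℝ}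
    {S : Set Plane} (hv : SegmentwiseH1On v S) (hS : MeasurableSet S) (hg : ‖g‖ = 1)
    (hδ : cross g d ≠ 0) {m σ κ : ℝ} (hm : 0 < m) (hσ : 0 < σ) (hκ : 0 ≤ κ) (hd : ‖d‖ * σ ≤ m)
    (hmem : ∀ t ∈ Icc 0 (3 * m), ∀ y ∈ Icc 0 σ, obliqueCoord A g d (t, y) ∈ S)
    (hsecond : ∀ t ∈ Icc 0 m, κ ≤ |v (A + (t + m + m) • g) - v (A + (t + m) • g)
      - (v (A + (t + m) • g) - v (A + t • g))|) :
    κ ^ 2 * σ ≤ 108 * m * (|(cross g d)⁻¹| * h1Seminorm S v ^ 2) := by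
  have hswap : cross d g ≠ 0 := by rwa [cross_swap, neg_ne_zero]
  have hgrad : Measurable fun x => ‖gradient v x‖ₑ := (measurable_gradient v).enorm
  have hvert := hv.ae_enorm_sub_le hδ hmem
  have hhor := hv.ae_enorm_sub_le (A := A) hswap fun y hy t ht => by
    rw [obliqueCoord_swap]
    exact hmem t ht y hy
  simp only [obliqueCoord_swap A g d, ← ofReal_norm g, hg, ENNReal.ofReal_one, one_mul] at hhor
  have h := sq_mul_le_setLIntegral_sq_of_second_difference
    (V := fun z => v (obliqueCoord A g d z)) (H := fun z => ‖gradient v (obliqueCoord A g d z)‖ₑ)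
    (D := ‖d‖ₑ) (κ := ENNReal.ofReal κ)
    (hgrad.comp (continuous_obliqueCoord A g d).measurable) hm hσ
    (by rw [← ofReal_norm, ← ENNReal.ofReal_mul (norm_nonneg _)]; exact ENNReal.ofReal_le_ofReal hd)
    (hvert.mono fun t ht hta y hy => ht hta 0 ⟨le_rfl, hσ.le⟩ y hy hy.1)
    (hhor.mono fun y hy hya t ht => hy hya t ⟨ht.1, by linarith [ht.2]⟩ (t + m)
      ⟨by linarith [ht.1], by linarith [ht.2]⟩ (by linarith))
    (fun t ht => by
      rw [← ofReal_norm, Real.norm_eq_abs]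
      simpa only [obliqueCoord, zero_smul, add_zero] using ENNReal.ofReal_le_ofReal (hsecond t ht))
  have hQ := setLIntegral_comp_obliqueCoord_le (A := A) hδ (hgrad.pow_const 2) hS
    (R := Icc 0 (3 * m) ×ˢ Icc 0 σ) fun z hz => hmem z.1 hz.1 z.2 hz.2
  rw [hv.lintegral_sq, ← h1Seminorm_sq, ← ENNReal.ofReal_mul (abs_nonneg _)] at hQ
  rw [← ENNReal.ofReal_le_ofReal_iff (by positivity), ENNReal.ofReal_mul (by positivity),
    ENNReal.ofReal_mul (p := 108 * m) (by positivity), ENNReal.ofReal_mul (p := 108) (by norm_num),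
    ENNReal.ofReal_pow hκ, ENNReal.ofReal_ofNat]
  exact h.trans (mul_le_mul_right hQ _)

lemma exists_mem_ball_half_le_abs_cross (hg : ‖g‖ = 1) (A z₀ : Plane) {r : ℝ} (hr : 0 < r) :
    ∃ z ∈ Metric.ball z₀ r, r / 2 ≤ |cross g (z - A)| := by
  have hgg : g 0 ^ 2 + g 1 ^ 2 = 1 := by
    have h := real_inner_self_eq_norm_sq g
    rw [hg, inner_plane] at h
    linarith
  have hnormal : ‖(!₂[-g 1, g 0] : Plane)‖ = 1 := by
    rw [EuclideanSpace.norm_eq, Real.sqrt_eq_one, Fin.sum_univ_two]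
    simpa [add_comm] using hgg
  have hball : ∀ s : ℝ, |s| = r / 2 → z₀ + s • !₂[-g 1, g 0] ∈ Metric.ball z₀ r := fun s hs => by
    rw [mem_ball_iff_norm, add_sub_cancel_left, norm_smul, hnormal, Real.norm_eq_abs, hs]
    linarith
  have hcross : ∀ s : ℝ, cross g (z₀ + s • !₂[-g 1, g 0] - A) = cross g (z₀ - A) + s := fun s => by
    simp only [cross, PiLp.add_apply, PiLp.sub_apply, PiLp.smul_apply, smul_eq_mul,
      Matrix.cons_val_zero, Matrix.cons_val_one]
    linear_combination s * hgg
  rcases le_total 0 (cross g (z₀ - A)) with h | h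
  · refine ⟨_, hball (r / 2) (abs_of_pos (by positivity)), ?_⟩
    rw [hcross]
    exact le_trans (by linarith) (le_abs_self _)
  · refine ⟨_, hball (-(r / 2)) (by rw [abs_neg, abs_of_pos (by positivity)]), ?_⟩
    rw [hcross]
    exact le_trans (by linarith) (neg_le_abs _)

lemma add_smul_add_smul_mem {E : Type*} [AddCommGroup E] [Module ℝ E] {S : Set E}
    (hS : Convex ℝ S) {A g z : E} {ℓ t y : ℝ} (hA : A ∈ S) (hA' : A + ℓ • g ∈ S) (hz : z ∈ S)
    (hℓ : 0 < ℓ) (ht : t ∈ Icc 0 (ℓ / 2)) (hy : y ∈ Icc 0 (1 / 2)) :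
    A + t • g + y • (z - A) ∈ S := by
  have htg : A + (2 * t / ℓ) • (A + ℓ • g - A) ∈ S :=
    hS.add_smul_sub_mem hA hA' ⟨div_nonneg (by linarith [ht.1]) hℓ.le,
      (div_le_one hℓ).2 (by linarith [ht.2])⟩
  have hyz : A + (2 * y) • (z - A) ∈ S :=
    hS.add_smul_sub_mem hA hz ⟨by linarith [hy.1], by linarith [hy.2]⟩
  have hmid := hS.midpoint_mem htg hyz
  rw [add_sub_cancel_left, smul_smul, div_mul_cancel₀ _ hℓ.ne', midpoint_eq_smul_add] at hmid
  convert hmid using 1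
  simp only [invOf_eq_inv]
  module

lemma SegmentwiseH1On.sq_le_h1Seminorm_of_second_difference {v : Plane → ℝ} {S : Set Plane}
    (hv : SegmentwiseH1On v S) (hS : Convex ℝ S) (hSm : MeasurableSet S)
    (hSb : Bornology.IsBounded S) {z₀ : Plane} {r : ℝ} (hr : 0 < r)
    (hball : Metric.ball z₀ r ⊆ S) (hg : ‖g‖ = 1) {m κ : ℝ} (hm : 0 < m) (hκ : 0 ≤ κ)
    (hA : A ∈ S) (hA' : A + (6 * m) • g ∈ S)
    (hsecond : ∀ t ∈ Icc 0 m, κ ≤ |v (A + (t + m + m) • g) - v (A + (t + m) • g)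
      - (v (A + (t + m) • g) - v (A + t • g))|) :
    κ ^ 2 ≤ 216 * (Metric.diam S / r) * h1Seminorm S v ^ 2 := by
  obtain ⟨z, hzb, hz⟩ := exists_mem_ball_half_le_abs_cross hg A z₀ hr
  set D := Metric.diam S
  have hcross : 0 < |cross g (z - A)| := (half_pos hr).trans_le hz
  have hmD : 6 * m ≤ D := by
    have h := Metric.dist_le_diam_of_mem hSb hA' hA
    rwa [dist_eq_norm, add_sub_cancel_left, norm_smul, hg, mul_one,
      Real.norm_of_nonneg (by positivity)] at h
  have hD : 0 < D := by linarith
  have hdD : ‖z - A‖ ≤ D := dist_eq_norm z A ▸ Metric.dist_le_diam_of_mem hSb (hball hzb) hA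
  have hmem : ∀ t ∈ Icc 0 (3 * m), ∀ y ∈ Icc 0 (m / D), obliqueCoord A g (z - A) (t, y) ∈ S :=
    fun t ht y hy => add_smul_add_smul_mem hS hA hA' (hball hzb) (by positivity)
      ⟨ht.1, by linarith [ht.2]⟩
      ⟨hy.1, hy.2.trans ((div_le_div_iff₀ hD two_pos).2 (by linarith))⟩
  have hrect := hv.sq_le_h1Seminorm_of_second_difference_rectangle hSm hg (abs_pos.1 hcross) hm
    (div_pos hm hD) hκ (by rw [← mul_div_assoc, div_le_iff₀ hD, mul_comm]; gcongr) hmem hsecond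
  have hinv : |(cross g (z - A))⁻¹| ≤ 2 / r := by
    rw [abs_inv, inv_le_comm₀ hcross (by positivity), inv_div]
    exact hz
  calc κ ^ 2 = κ ^ 2 * (m / D) * (D / m) := by field_simp
    _ ≤ 108 * m * (2 / r * h1Seminorm S v ^ 2) * (D / m) := 
        mul_le_mul_of_nonneg_right (hrect.trans (by gcongr)) (by positivity)
    _ = 216 * (D / r) * h1Seminorm S v ^ 2 := by field_simp; ring

end ObliqueCoordinates

section FiniteElementError

variable {T : Geometry.SimplicialComplex ℝ Plane} {Ω : Set Plane} {U : Plane → ℝ}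
  {s : Finset Plane}

/-- The error `u - U`. -/
noncomputable def err (U : Plane → ℝ) : Plane → ℝ := fun x => uExact x - U x

/-- The gradient of a function `U` which is affine on the triangle `s`, an arbitrary vector if `U`
is not affine there. -/
noncomputable def elementGradient (U : Plane → ℝ) (s : Finset Plane) : Plane :=
  Classical.epsilon fun G => ∀ x ∈ body s, ∀ y ∈ body s, U x - U y = inner ℝ G (x - y)

lemma sub_eq_inner_elementGradient (hU : U ∈ X T) (hs : s ∈ elements T) {x y : Plane}
    (hx : x ∈ body s) (hy : y ∈ body s) :
    U x - U y = inner ℝ (elementGradient U s) (x - y) := by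
  obtain ⟨f, hf⟩ := hU.2 s hs
  refine Classical.epsilon_spec (p := fun G => ∀ x ∈ body s, ∀ y ∈ body s,
    U x - U y = inner ℝ G (x - y))
    ⟨(InnerProductSpace.toDual ℝ Plane).symm f.linear.toContinuousLinearMap,
      fun x hx y hy => ?_⟩ x hx y hy
  rw [hf hx, hf hy, InnerProductSpace.toDual_symm_apply]
  exact (f.linearMap_vsub x y).symm

lemma uExact_eq (x : Plane) : uExact x = ‖x‖ ^ 2 := by
  rw [uExact, EuclideanSpace.real_norm_sq_eq, Fin.sum_univ_two]

lemma hasGradientAt_uExact (x : Plane) : HasGradientAt uExact ((2 : ℝ) • x) x := by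
  rw [hasGradientAt_iff_hasFDerivAt, funext uExact_eq]
  refine (hasStrictFDerivAt_norm_sq x).hasFDerivAt.congr_fderiv ?_
  ext y
  simp

lemma hasGradientAt_err (hU : U ∈ X T) (hs : s ∈ elements T) {x : Plane}
    (hx : x ∈ interior (body s)) :
    HasGradientAt (err U) ((2 : ℝ) • x - elementGradient U s) x := by
  have hgrad : HasGradientAt U (elementGradient U s) x := by
    rw [hasGradientAt_iff_hasFDerivAt]
    refine ((InnerProductSpace.toDual ℝ Plane (elementGradient U s)).hasFDerivAt.add_const
      (U x - inner ℝ (elementGradient U s) x)).congr_of_eventuallyEq ?_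
    filter_upwards [mem_interior_iff_mem_nhds.1 hx] with y hy
    have h := sub_eq_inner_elementGradient hU hs hy (interior_subset hx)
    rw [inner_sub_right] at h
    rw [InnerProductSpace.toDual_apply_apply]
    linarith
  rw [hasGradientAt_iff_hasFDerivAt, map_sub]
  exact (hasGradientAt_uExact x).hasFDerivAt.sub hgrad.hasFDerivAt

lemma differentiableOn_err (hU : U ∈ X T) (hs : s ∈ elements T) :
    DifferentiableOn ℝ (err U) (body s) := by
  obtain ⟨f, hf⟩ := hU.2 s hs
  have hu : Differentiable ℝ uExact := fun x =>
    (hasGradientAt_uExact x).hasFDerivAt.differentiableAt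
  have hfd : Differentiable ℝ f :=
    ContinuousAffineMap.differentiable ⟨f, f.continuous_of_finiteDimensional⟩
  exact (hu.sub hfd).differentiableOn.congr fun x hx => congrArg (uExact x - ·) (hf hx)

lemma norm_gradient_err_sq_ae_eq (hU : U ∈ X T) (hs : s ∈ elements T) :
    (fun x => ‖gradient (err U) x‖ ^ 2)
      =ᵐ[volume.restrict (body s)] fun x => ‖(2 : ℝ) • x - elementGradient U s‖ ^ 2 := by
  rw [← Measure.restrict_congr_set (interior_body_ae_eq s)]
  filter_upwards [ae_restrict_mem isOpen_interior.measurableSet] with x hx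
  rw [(hasGradientAt_err hU hs hx).gradient]

lemma integrableOn_norm_gradient_err_sq (hU : U ∈ X T) (hs : s ∈ elements T) :
    IntegrableOn (fun x => ‖gradient (err U) x‖ ^ 2) (body s) := by
  have hcont : ContinuousOn (fun x => ‖(2 : ℝ) • x - elementGradient U s‖ ^ 2) (body s) := by
    fun_prop
  exact (hcont.integrableOn_compact (isCompact_body s)).congr
    (norm_gradient_err_sq_ae_eq hU hs).symm

lemma segmentwiseH1On_err (hT : IsTriangulation T Ω) (hΩ : IsOpen Ω) (hU : U ∈ X T) :
    SegmentwiseH1On (err U) (closure Ω) where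
  continuousOn := by
    have hu : Continuous uExact := by
      rw [funext uExact_eq]
      fun_prop
    exact hu.continuousOn.sub (hT.space_eq ▸ hU.1)
  differentiableAt_line A d a b hab :=
    exists_countable_differentiableAt_line hT.finite_elements.countable
      (fun s _ => convex_body s) (fun s _ => isClosed_body s)
      (fun s hs => differentiableOn_err hU hs)
      (by simpa only [hT.closure_eq_biUnion_elements hΩ] using hab)
  ae_differentiableAt := by
    filter_upwards [hT.ae_mem_interior_body hΩ] with x hx hxΩ
    obtain ⟨s, hs, hxs⟩ := hx hxΩ
    exact (hasGradientAt_err hU hs hxs).hasFDerivAt.differentiableAt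
  integrableOn_sq := by
    rw [hT.closure_eq_biUnion_elements hΩ, integrableOn_finite_biUnion hT.finite_elements]
    exact fun s hs => integrableOn_norm_gradient_err_sq hU hs

lemma IsTriangulation.h1Seminorm_closure (hT : IsTriangulation T Ω)
    (hΩ : interior (closure Ω) = Ω) (v : Plane → ℝ) :
    h1Seminorm (closure Ω) v = h1Seminorm Ω v :=
  congrArg Real.sqrt (setIntegral_congr_set (hT.closure_ae_eq hΩ))

/-- The error indicator of the triangle `s` for the mesh size `h`: it dominates the mean square
deviation of the gradient of `U` on `s` from the gradient of `u` at any point of `s`. -/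
noncomputable def errorIndicator (U : Plane → ℝ) (h : ℝ) (s : Finset Plane) : ℝ :=
  ∫ x in body s, (2 * ‖gradient (err U) x‖ ^ 2 + 8 * h ^ 2)

lemma area_mul_norm_elementGradient_sub_sq_le (hU : U ∈ X T) (hs : s ∈ elements T) {P : Plane}
    (hP : P ∈ body s) {h : ℝ} (hh : Metric.diam (body s) ≤ h) :
    area s * ‖elementGradient U s - (2 : ℝ) • P‖ ^ 2 ≤ errorIndicator U h s := by
  have hfin : volume (body s) ≠ ⊤ := (isCompact_body s).measure_lt_top.ne
  rw [area, errorIndicator, ← smul_eq_mul, ← setIntegral_const]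
  refine integral_mono_ae (integrableOn_const hfin)
    (((integrableOn_norm_gradient_err_sq hU hs).const_mul 2).add (integrableOn_const hfin)) ?_
  filter_upwards [norm_gradient_err_sq_ae_eq hU hs,
    ae_restrict_mem (isClosed_body s).measurableSet] with x hx hxs
  have hdist : ‖x - P‖ ≤ h := dist_eq_norm x P ▸
    (Metric.dist_le_diam_of_mem (isCompact_body s).isBounded hxs hP).trans hh
  have htri : ‖elementGradient U s - (2 : ℝ) • P‖
      ≤ ‖(2 : ℝ) • x - elementGradient U s‖ + 2 * h := by
    calc ‖elementGradient U s - (2 : ℝ) • P‖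
        = ‖(2 : ℝ) • (x - P) - ((2 : ℝ) • x - elementGradient U s)‖ := by congr 1; module
      _ ≤ ‖(2 : ℝ) • (x - P)‖ + ‖(2 : ℝ) • x - elementGradient U s‖ := norm_sub_le _ _
      _ ≤ ‖(2 : ℝ) • x - elementGradient U s‖ + 2 * h := by
        rw [norm_smul, Real.norm_ofNat]
        linarith
  calc ‖elementGradient U s - (2 : ℝ) • P‖ ^ 2
      ≤ (‖(2 : ℝ) • x - elementGradient U s‖ + 2 * h) ^ 2 := by gcongr
    _ ≤ 2 * (‖(2 : ℝ) • x - elementGradient U s‖ ^ 2 + (2 * h) ^ 2) := add_sq_le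
    _ = 2 * ‖gradient (err U) x‖ ^ 2 + 8 * h ^ 2 := by rw [hx]; ring

lemma sum_errorIndicator_le {S : Set Plane} (hv : SegmentwiseH1On (err U) S) (hS : volume S ≠ ⊤)
    {ι : Type*} {I : Finset ι} {k : ι → Finset Plane} (hk : InjOn k I)
    (hmem : ∀ i ∈ I, k i ∈ elements T) (hsub : ∀ i ∈ I, body (k i) ⊆ S) (h : ℝ) :
    ∑ i ∈ I, errorIndicator U h (k i)
      ≤ 2 * h1Seminorm S (err U) ^ 2 + 8 * h ^ 2 * volume.real S := by
  have hint := hv.integrableOn_sq.const_mul 2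
  have hadd : IntegrableOn (fun x => 2 * ‖gradient (err U) x‖ ^ 2 + 8 * h ^ 2) S :=
    hint.add (integrableOn_const hS)
  calc ∑ i ∈ I, errorIndicator U h (k i)
      ≤ ∫ x in S, (2 * ‖gradient (err U) x‖ ^ 2 + 8 * h ^ 2) :=
        sum_setIntegral_body_le (fun x => by positivity) hadd hk hmem hsub
    _ = 2 * h1Seminorm S (err U) ^ 2 + 8 * h ^ 2 * volume.real S := by
        rw [integral_add hint (integrableOn_const hS), integral_const_mul, setIntegral_const,
          h1Seminorm_sq, smul_eq_mul, mul_comm (volume.real S)]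

lemma uExact_second_difference {g : Plane} (hg : ‖g‖ = 1) (A : Plane) (t m : ℝ) :
    uExact (A + (t + m + m) • g) - uExact (A + (t + m) • g)
      - (uExact (A + (t + m) • g) - uExact (A + t • g)) = 2 * m ^ 2 := by
  have hquad (x : ℝ) : uExact (A + x • g) = ‖A‖ ^ 2 + 2 * (x * inner ℝ A g) + x ^ 2 := by
    rw [uExact_eq, norm_add_sq_real, real_inner_smul_right, norm_smul, hg, mul_one,
      Real.norm_eq_abs, sq_abs]
  rw [hquad, hquad, hquad]
  ring

end FiniteElementError

section PiecewiseAffine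

lemma abs_sub_le_mul_of_forall_piece {N : ℕ} {t : ℕ → ℝ} {w : ℝ → ℝ} {τ : ℝ}
    (ht : ∀ k < N, t k ≤ t (k + 1))
    (hw : ∀ k < N, ∀ x ∈ Icc (t k) (t (k + 1)), ∀ y ∈ Icc (t k) (t (k + 1)), x ≤ y →
      |w y - w x| ≤ τ * (y - x)) {x y : ℝ} (hx : t 0 ≤ x) (hxy : x ≤ y) (hy : y ≤ t N) :
    |w y - w x| ≤ τ * (y - x) := by
  induction N generalizing x y with
  | zero => simp [le_antisymm hxy (hy.trans hx)]
  | succ N ih =>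
    have ih' {x y : ℝ} := ih (x := x) (y := y) (fun k hk => ht k (by omega))
      (fun k hk => hw k (by omega))
    rcases le_total y (t N) with hyN | hyN
    · exact ih' hx hxy hyN
    rcases le_total (t N) x with hxN | hxN
    · exact hw N (by omega) x ⟨hxN, hxy.trans hy⟩ y ⟨hyN, hy⟩ hxy
    calc |w y - w x| ≤ |w y - w (t N)| + |w (t N) - w x| := abs_sub_le _ _ _
      _ ≤ τ * (y - t N) + τ * (t N - x) := add_le_add
          (hw N (by omega) (t N) ⟨le_rfl, ht N (by omega)⟩ y ⟨hyN, hy⟩ hyN) (ih' hx hxN le_rfl)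
      _ = τ * (y - x) := by ring

lemma abs_sub_zero_le_sum_abs_sub_pred (m : ℕ → ℝ) (k : ℕ) :
    |m k - m 0| ≤ ∑ i ∈ Finset.Icc 1 k, |m i - m (i - 1)| := by
  induction k with
  | zero => simp
  | succ k ih =>
    rw [Finset.sum_Icc_succ_top (by omega), Nat.add_sub_cancel]
    linarith [abs_sub_le (m (k + 1)) (m k) (m 0)]

lemma abs_sub_sub_le_of_slope_variation {N : ℕ} {t m : ℕ → ℝ} {w : ℝ → ℝ}
    (ht : ∀ i ≤ N, t i ≤ t (i + 1))
    (hw : ∀ i ≤ N, ∀ x ∈ Icc (t i) (t (i + 1)), ∀ y ∈ Icc (t i) (t (i + 1)),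
      w x - w y = m i * (x - y)) {x y : ℝ} (hx : t 0 ≤ x) (hxy : x ≤ y) (hy : y ≤ t (N + 1)) :
    |w y - w x - m 0 * (y - x)| ≤ (∑ i ∈ Finset.Icc 1 N, |m i - m (i - 1)|) * (y - x) := by
  have hslope (k : ℕ) (hk : k ≤ N) : |m k - m 0| ≤ ∑ i ∈ Finset.Icc 1 N, |m i - m (i - 1)| :=
    (abs_sub_zero_le_sum_abs_sub_pred m k).trans (Finset.sum_le_sum_of_subset_of_nonneg
      (Finset.Icc_subset_Icc_right hk) fun _ _ _ => abs_nonneg _)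
  have h := abs_sub_le_mul_of_forall_piece (w := fun x => w x - m 0 * x)
    (τ := ∑ i ∈ Finset.Icc 1 N, |m i - m (i - 1)|) (fun k hk => ht k (Nat.lt_succ_iff.1 hk))
    (fun k hk x hx y hy hxy => ?_) hx hxy hy
  · convert h using 2
    ring
  · have hk' := Nat.lt_succ_iff.1 hk
    calc |w y - m 0 * y - (w x - m 0 * x)| = |(m k - m 0) * (y - x)| := by
          congr 1
          linear_combination hw k hk' y hy x hx
      _ = |m k - m 0| * (y - x) := by rw [abs_mul, abs_of_nonneg (sub_nonneg.2 hxy)]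
      _ ≤ _ := mul_le_mul_of_nonneg_right (hslope k hk') (sub_nonneg.2 hxy)

end PiecewiseAffine

section UnitVectors

open NormedSpace

variable {V : Type*} [NormedAddCommGroup V] [InnerProductSpace ℝ V]

lemma norm_normalize_sub_normalize_sq {x y : V} (hx : x ≠ 0) (hy : y ≠ 0) :
    ‖normalize x - normalize y‖ ^ 2 = 2 - 2 * Real.cos (InnerProductGeometry.angle x y) := by
  have hx' : ‖normalize x‖ = 1 := norm_normalize_eq_one_iff.2 hx
  have hy' : ‖normalize y‖ = 1 := norm_normalize_eq_one_iff.2 hy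
  rw [norm_sub_sq_real, ← InnerProductGeometry.cos_angle_mul_norm_mul_norm,
    InnerProductGeometry.angle_normalize_left, InnerProductGeometry.angle_normalize_right, hx', hy']
  ring

lemma norm_normalize_sub_normalize_le_two_mul_sin {p q q' : V} (hq : q ≠ p) (hq' : q' ≠ p)
    (h₁ : EuclideanGeometry.angle p q' q ≤ EuclideanGeometry.angle q' p q)
    (h₂ : EuclideanGeometry.angle q' q p ≤ EuclideanGeometry.angle q' p q) :
    ‖normalize (q - p) - normalize (p - q')‖
      ≤ 2 * Real.sin (Real.pi - EuclideanGeometry.angle q' p q) := by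
  have hsum := EuclideanGeometry.angle_add_angle_add_angle_eq_pi q hq'
  rw [EuclideanGeometry.angle_comm q p q'] at hsum
  have hangle : InnerProductGeometry.angle (q - p) (p - q')
      = Real.pi - EuclideanGeometry.angle q' p q := by
    rw [← neg_sub q' p, InnerProductGeometry.angle_neg_right, InnerProductGeometry.angle_comm]
    rfl
  have hsq := norm_normalize_sub_normalize_sq (sub_ne_zero.2 hq) (sub_ne_zero.2 hq'.symm)
  rw [hangle] at hsq
  set β := Real.pi - EuclideanGeometry.angle q' p q
  have hβ₀ : 0 ≤ β := sub_nonneg.2 (EuclideanGeometry.angle_le_pi _ _ _)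
  have hβ : β ≤ Real.pi - Real.pi / 3 := by linarith
  have hcos : -(1 / 2) ≤ Real.cos β := by
    rw [← Real.cos_pi_div_three, ← Real.cos_pi_sub]
    exact Real.cos_le_cos_of_nonneg_of_le_pi hβ₀ (by linarith [Real.pi_pos]) hβ
  have hsin : 0 ≤ Real.sin β :=
    Real.sin_nonneg_of_nonneg_of_le_pi hβ₀ (by linarith [Real.pi_pos])
  refine le_of_sq_le_sq ?_ (by positivity)
  calc _ = 2 * (1 - Real.cos β) := by rw [hsq]; ring
    _ ≤ 4 * ((1 - Real.cos β) * (1 + Real.cos β)) := by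
      nlinarith [mul_nonneg (sub_nonneg.2 (Real.cos_le_one β)) (by linarith :
        0 ≤ Real.cos β + 1 / 2)]
    _ = (2 * Real.sin β) ^ 2 := by rw [mul_pow, Real.sin_sq]; ring

lemma inner_sub_nonneg_of_angle_le {a b c : V} (hab : a ≠ b)
    (h : EuclideanGeometry.angle a b c ≤ EuclideanGeometry.angle b a c) :
    0 ≤ inner ℝ (a - b) (c - b) := by
  have hsum := EuclideanGeometry.angle_add_angle_add_angle_eq_pi c hab.symm
  rw [EuclideanGeometry.angle_comm c a b] at hsum
  have hle : InnerProductGeometry.angle (a - b) (c - b) ≤ Real.pi / 2 := by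
    change EuclideanGeometry.angle a b c ≤ _
    linarith [EuclideanGeometry.angle_nonneg b c a]
  rw [← InnerProductGeometry.cos_angle_mul_norm_mul_norm]
  refine mul_nonneg (Real.cos_nonneg_of_neg_pi_div_two_le_of_le ?_ hle) (by positivity)
  linarith [InnerProductGeometry.angle_nonneg (a - b) (c - b), Real.pi_pos]

lemma norm_sub_le_norm_sub_of_opposite_sides {g n e e' : Plane} (hg : ‖g‖ = 1) (he' : ‖e'‖ = 1)
    (hng : inner ℝ n g = 0) (hn : inner ℝ n e * inner ℝ n e' < 0)
    (hge : 0 ≤ inner ℝ g e) : ‖e - g‖ ≤ ‖e - e'‖ := by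
  have hcross (x : Plane) : inner ℝ n x = cross g n * cross g x := by
    have h := norm_sq_mul_inner g n x
    rwa [hg, real_inner_comm n g, hng, one_pow, one_mul, zero_mul, zero_add] at h
  have hneg : cross g e * cross g e' ≤ 0 := by
    rw [hcross, hcross] at hn
    by_contra! h
    nlinarith [mul_nonneg (sq_nonneg (cross g n)) h.le]
  have hle : inner ℝ g e' ≤ 1 := by
    simpa only [hg, he', mul_one] using real_inner_le_norm g e'
  have hinner : inner ℝ e e' ≤ inner ℝ e g := by
    have h := norm_sq_mul_inner g e e'
    rw [hg, one_pow, one_mul] at h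
    rw [h, real_inner_comm g e]
    linarith [mul_le_of_le_one_right hge hle]
  refine le_of_sq_le_sq ?_ (norm_nonneg _)
  rw [norm_sub_sq_real, norm_sub_sq_real, hg, he']
  linarith

lemma abs_inner_sub_le {g e₁ e₂ a a₁ a₂ : V} (c : V) (ha₁ : inner ℝ a e₁ = inner ℝ a₁ e₁)
    (ha₂ : inner ℝ a e₂ = inner ℝ a₂ e₂) {δ : ℝ} (hδ : ‖e₂ - e₁‖ ≤ δ) (hδ₁ : ‖e₁ - g‖ ≤ δ)
    (hδ₂ : ‖e₂ - g‖ ≤ δ) :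
    |inner ℝ a₂ g - inner ℝ a₁ g| ≤ δ * (‖a - c‖ + ‖a₂ - c‖ + ‖a₁ - c‖) := by
  have hbound (x y : V) (hy : ‖y‖ ≤ δ) : |inner ℝ x y| ≤ δ * ‖x‖ := by
    rw [mul_comm]
    exact (abs_real_inner_le_norm x y).trans (mul_le_mul_of_nonneg_left hy (norm_nonneg x))
  calc |inner ℝ a₂ g - inner ℝ a₁ g|
      = |inner ℝ (a - c) (e₂ - e₁) - inner ℝ (a₂ - c) (e₂ - g) + inner ℝ (a₁ - c) (e₁ - g)| := by
        simp only [inner_sub_left, inner_sub_right]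
        rw [ha₁, ha₂]
        congr 1
        ring
    _ ≤ |inner ℝ (a - c) (e₂ - e₁)| + |inner ℝ (a₂ - c) (e₂ - g)|
          + |inner ℝ (a₁ - c) (e₁ - g)| :=
        (abs_add_le _ _).trans (add_le_add_left (abs_sub _ _) _)
    _ ≤ δ * ‖a - c‖ + δ * ‖a₂ - c‖ + δ * ‖a₁ - c‖ := by
        gcongr
        exacts [hbound _ _ hδ, hbound _ _ hδ₂, hbound _ _ hδ₁]
    _ = δ * (‖a - c‖ + ‖a₂ - c‖ + ‖a₁ - c‖) := by ring

end UnitVectors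

lemma left_mem_body_tri (a b c : Plane) : a ∈ body (tri a b c) := mem_body_of_mem (by simp [tri])

lemma middle_mem_body_tri (a b c : Plane) : b ∈ body (tri a b c) := mem_body_of_mem (by simp [tri])

lemma right_mem_body_tri (a b c : Plane) : c ∈ body (tri a b c) := mem_body_of_mem (by simp [tri])

lemma inner_elementGradient_eq {T : Geometry.SimplicialComplex ℝ Plane} {U : Plane → ℝ}
    (hU : U ∈ X T) {s s' : Finset Plane} (hs : s ∈ elements T) (hs' : s' ∈ elements T) {x y : Plane}
    (hx : x ∈ body s ∩ body s') (hy : y ∈ body s ∩ body s') :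
    inner ℝ (elementGradient U s) (NormedSpace.normalize (x - y))
      = inner ℝ (elementGradient U s') (NormedSpace.normalize (x - y)) := by
  rw [NormedSpace.normalize, real_inner_smul_right, real_inner_smul_right,
    ← sub_eq_inner_elementGradient hU hs hx.1 hy.1, ← sub_eq_inner_elementGradient hU hs' hx.2 hy.2]

namespace Band

open NormedSpace

variable {T : Geometry.SimplicialComplex ℝ Plane} {Ω : Set Plane} {U : Plane → ℝ} (B : Band T)

/-- The position of `p k` on the edge `Γ`, as its signed distance from `p 0`. -/
noncomputable def abscissa (k : ℕ) : ℝ := inner ℝ (B.p k - B.p 0) B.g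

/-- The derivative along `Γ` of a function `U ∈ X T` on the element `K i`. -/
noncomputable def slope (U : Plane → ℝ) (i : ℕ) : ℝ := inner ℝ (elementGradient U (B.K i)) B.g

/-- The jump at `p i`, for `1 ≤ i ≤ N`, of the derivative of `U` along `Γ`. -/
noncomputable def jump (U : Plane → ℝ) (i : ℕ) : ℝ := B.slope U i - B.slope U (i - 1)

lemma abscissa_zero : B.abscissa 0 = 0 := by simp [abscissa]

lemma p_succ_and_abscissa_lt_succ {i : ℕ} (hi : i ≤ B.N) :
    B.p (i + 1) = B.p i + (B.abscissa (i + 1) - B.abscissa i) • B.g ∧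
      B.abscissa i < B.abscissa (i + 1) := by
  obtain ⟨ℓ, hℓ, hp⟩ := B.straight i hi
  have hsub : B.abscissa (i + 1) - B.abscissa i = ℓ := by
    rw [abscissa, abscissa, ← inner_sub_left, sub_sub_sub_cancel_right, hp, add_sub_cancel_left,
      real_inner_smul_left, real_inner_self_eq_norm_sq, B.norm_g, one_pow, mul_one]
  exact ⟨by rw [hsub, hp], sub_pos.1 (hsub ▸ hℓ)⟩

lemma p_eq {k : ℕ} (hk : k ≤ B.N + 1) : B.p k = B.p 0 + B.abscissa k • B.g := by
  induction k with
  | zero => rw [abscissa_zero, zero_smul, add_zero]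
  | succ k ih =>
    rw [(B.p_succ_and_abscissa_lt_succ (by omega)).1, ih (by omega), add_assoc, ← add_smul,
      add_sub_cancel]

lemma strictMonoOn_abscissa : StrictMonoOn B.abscissa (Iic (B.N + 1)) :=
  strictMonoOn_of_lt_succ ordConnected_Iic fun _ _ _ hi =>
    (B.p_succ_and_abscissa_lt_succ (Nat.le_of_succ_le_succ hi)).2

lemma p_injOn : InjOn B.p (Iic (B.N + 1)) := fun _ hi _ hj h =>
  B.strictMonoOn_abscissa.injOn hi hj (by rw [abscissa, abscissa, h])

lemma exists_normal : ∃ n : Plane, inner ℝ n B.g = 0 ∧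
    ∀ k ≤ B.N + 1, ∀ j ≤ B.N, 0 < inner ℝ n (B.q j - B.p k) := by
  obtain ⟨n, hn, hq⟩ := B.one_side
  refine ⟨n, hn, fun k hk j hj => ?_⟩
  have hjk := hq j hj
  rwa [B.p_eq hk, ← sub_sub, inner_sub_right, real_inner_smul_right, hn, mul_zero, sub_zero]

lemma q_ne_p {k j : ℕ} (hk : k ≤ B.N + 1) (hj : j ≤ B.N) : B.q j ≠ B.p k := by
  obtain ⟨n, -, hn⟩ := B.exists_normal
  intro h
  simpa only [h, sub_self, inner_zero_right, lt_irrefl] using hn k hk j hj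

lemma abscissa_last_pos : 0 < B.abscissa (B.N + 1) :=
  B.abscissa_zero ▸ B.strictMonoOn_abscissa (Nat.zero_le _) (mem_Iic.2 le_rfl) (Nat.succ_pos _)

lemma L_eq_abscissa : B.L = B.abscissa (B.N + 1) := by
  rw [L, B.p_eq le_rfl, dist_self_add_right, norm_smul, B.norm_g, mul_one, Real.norm_eq_abs,
    abs_of_pos B.abscissa_last_pos]

lemma L_pos : 0 < B.L := B.L_eq_abscissa ▸ B.abscissa_last_pos

lemma elems_subset_elements : B.elems ⊆ elements T := by
  rintro s (⟨i, hi, rfl⟩ | ⟨i, hi, rfl⟩)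
  exacts [B.K_mem i hi, B.Kt_mem i hi]

lemma K_injOn : InjOn B.K (Iic B.N) := by
  have hmem {i j : ℕ} (hi : i ≤ B.N) (hj : j ≤ B.N) (h : B.K i = B.K j) : i = j ∨ i = j + 1 := by
    have hp : B.p i ∈ B.K j := by rw [← h]; simp [K, tri]
    simp only [K, tri, Finset.mem_insert, Finset.mem_singleton] at hp
    rcases hp with hp | hp | hp
    · exact Or.inl (B.p_injOn (by grind) (by grind) hp)
    · exact Or.inr (B.p_injOn (by grind) (by grind) hp)
    · exact absurd hp.symm (B.q_ne_p (by omega) hj)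
  intro i hi j hj h
  have hij := hmem hi hj h
  have hji := hmem hj hi h.symm
  omega

lemma Kt_injOn : InjOn B.Kt (Finset.Icc 1 B.N) := by
  intro i hi j hj h
  rw [Finset.coe_Icc, mem_Icc] at hi hj
  have hp : B.p i ∈ B.Kt j := by rw [← h]; simp [Kt, tri]
  simp only [Kt, tri, Finset.mem_insert, Finset.mem_singleton] at hp
  rcases hp with hp | hp | hp
  · exact B.p_injOn (mem_Iic.2 (by omega)) (mem_Iic.2 (by omega)) hp
  · exact absurd hp.symm (B.q_ne_p (by omega) (by omega))
  · exact absurd hp.symm (B.q_ne_p (by omega) (by omega))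

lemma add_smul_mem_body_K {i : ℕ} (hi : i ≤ B.N) {x : ℝ}
    (hx : x ∈ Icc (B.abscissa i) (B.abscissa (i + 1))) : B.p 0 + x • B.g ∈ body (B.K i) := by
  let f : ℝ →ᵃ[ℝ] Plane := AffineMap.lineMap (B.p 0) (B.p 0 + B.g)
  have hf (t : ℝ) : f t = B.p 0 + t • B.g := by
    rw [AffineMap.lineMap_apply, vsub_eq_sub, vadd_eq_add, add_sub_cancel_left, add_comm]
  have hleft : f (B.abscissa i) ∈ body (B.K i) := by
    rw [hf, ← B.p_eq (by omega)]
    exact left_mem_body_tri _ _ _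
  have hright : f (B.abscissa (i + 1)) ∈ body (B.K i) := by
    rw [hf, ← B.p_eq (by omega)]
    exact middle_mem_body_tri _ _ _
  rw [← segment_eq_Icc (hx.1.trans hx.2)] at hx
  rw [← hf]
  exact ((convex_body _).affine_preimage f).segment_subset hleft hright hx

lemma add_smul_mem_closure (hT : IsTriangulation T Ω) {x : ℝ} (hx : x ∈ Icc 0 B.L) :
    B.p 0 + x • B.g ∈ closure Ω := by
  have hK {i : ℕ} (hi : i ≤ B.N) {t : ℝ} (ht : t ∈ Icc (B.abscissa i) (B.abscissa (i + 1))) :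
      B.p 0 + t • B.g ∈ closure Ω :=
    hT.body_subset_closure (B.K_mem i hi) (B.add_smul_mem_body_K hi ht)
  have hcover : ∀ k ≤ B.N, ∀ t ∈ Icc 0 (B.abscissa (k + 1)), B.p 0 + t • B.g ∈ closure Ω := by
    intro k
    induction k with
    | zero => exact fun hk t ht => hK hk (B.abscissa_zero.symm ▸ ht)
    | succ k ih =>
      intro hk t ht
      rcases le_total t (B.abscissa (k + 1)) with h | h
      exacts [ih (by omega) t ⟨ht.1, h⟩, hK hk ⟨h, ht.2⟩]
  exact hcover B.N le_rfl x (B.L_eq_abscissa ▸ hx)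

lemma region_subset_closure (hT : IsTriangulation T Ω) : B.region ⊆ closure Ω :=
  iUnion₂_subset fun _ hs => hT.body_subset_closure (B.elems_subset_elements hs)

lemma sub_eq_slope_mul (hU : U ∈ X T) {i : ℕ} (hi : i ≤ B.N) {x y : ℝ}
    (hx : x ∈ Icc (B.abscissa i) (B.abscissa (i + 1)))
    (hy : y ∈ Icc (B.abscissa i) (B.abscissa (i + 1))) :
    U (B.p 0 + x • B.g) - U (B.p 0 + y • B.g) = B.slope U i * (x - y) := by
  rw [sub_eq_inner_elementGradient hU (B.K_mem i hi) (B.add_smul_mem_body_K hi hx)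
    (B.add_smul_mem_body_K hi hy), add_sub_add_left_eq_sub, ← sub_smul, real_inner_smul_right,
    mul_comm]
  rfl

lemma inner_q_sub_p_nonneg {i : ℕ} (hi : i ≤ B.N) : 0 ≤ inner ℝ B.g (B.q i - B.p i) := by
  obtain ⟨ℓ, hℓ, hp⟩ := B.straight i hi
  have h := inner_sub_nonneg_of_angle_le (B.q_ne_p (by omega) hi) (B.K_maxAngle i hi).1
  rw [hp, add_sub_cancel_left, real_inner_smul_right, real_inner_comm] at h
  exact nonneg_of_mul_nonneg_right h hℓ

lemma inner_p_succ_sub_q_nonneg {i : ℕ} (hi : i ≤ B.N) :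
    0 ≤ inner ℝ B.g (B.p (i + 1) - B.q i) := by
  obtain ⟨ℓ, hℓ, hp⟩ := B.straight i hi
  have hangle := (B.K_maxAngle i hi).2
  rw [EuclideanGeometry.angle_comm, EuclideanGeometry.angle_comm _ (B.q i)] at hangle
  have h := inner_sub_nonneg_of_angle_le (B.q_ne_p (by omega) hi) hangle
  have hsub : B.p i - B.p (i + 1) = -(ℓ • B.g) := by rw [hp]; abel
  rw [hsub, inner_neg_right, ← inner_neg_left, neg_sub, real_inner_smul_right,
    real_inner_comm] at h
  exact nonneg_of_mul_nonneg_right h hℓ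

lemma norm_normalize_edge_sub_le {i : ℕ} (hi : i + 1 ≤ B.N) :
    ‖normalize (B.q (i + 1) - B.p (i + 1)) - normalize (B.p (i + 1) - B.q i)‖
        ≤ 2 * Real.sin (Real.pi - B.αt (i + 1)) ∧
      ‖normalize (B.p (i + 1) - B.q i) - B.g‖ ≤ 2 * Real.sin (Real.pi - B.αt (i + 1)) ∧
      ‖normalize (B.q (i + 1) - B.p (i + 1)) - B.g‖
        ≤ 2 * Real.sin (Real.pi - B.αt (i + 1)) := by
  have hq : B.q (i + 1) ≠ B.p (i + 1) := B.q_ne_p (by omega) hi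
  have hq' : B.q i ≠ B.p (i + 1) := B.q_ne_p (by omega) (by omega)
  obtain ⟨hmax, hmax'⟩ := B.Kt_maxAngle (i + 1) (Finset.mem_Icc.2 ⟨by omega, hi⟩)
  have hδ := norm_normalize_sub_normalize_le_two_mul_sin hq hq' hmax hmax'
  obtain ⟨n, hng, hn⟩ := B.exists_normal
  have hopp : inner ℝ n (normalize (B.p (i + 1) - B.q i))
      * inner ℝ n (normalize (B.q (i + 1) - B.p (i + 1))) < 0 := by
    have hleft := hn (i + 1) (by omega) i (by omega)
    rw [← neg_sub, inner_neg_right, neg_pos] at hleft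
    simp only [NormedSpace.normalize, real_inner_smul_right]
    exact mul_neg_of_neg_of_pos
      (mul_neg_of_pos_of_neg (inv_pos.2 (norm_sub_pos_iff.2 hq'.symm)) hleft)
      (mul_pos (inv_pos.2 (norm_sub_pos_iff.2 hq)) (hn (i + 1) (by omega) (i + 1) hi))
  have hinner {x : Plane} (hx : 0 ≤ inner ℝ B.g x) : 0 ≤ inner ℝ B.g (normalize x) := by
    rw [NormedSpace.normalize, real_inner_smul_right]
    positivity
  have hu := norm_normalize_eq_one_iff.2 (sub_ne_zero.2 hq)
  have hu' := norm_normalize_eq_one_iff.2 (sub_ne_zero.2 hq'.symm)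
  refine ⟨hδ, ?_, ?_⟩
  · refine le_trans ?_ ((norm_sub_rev _ _).trans_le hδ)
    exact norm_sub_le_norm_sub_of_opposite_sides B.norm_g hu hng hopp
      (hinner (B.inner_p_succ_sub_q_nonneg (by omega)))
  · refine le_trans ?_ hδ
    exact norm_sub_le_norm_sub_of_opposite_sides B.norm_g hu' hng (by rwa [mul_comm])
      (hinner (B.inner_q_sub_p_nonneg hi))

lemma abs_jump_le (hU : U ∈ X T) {i : ℕ} (hi : i ∈ Finset.Icc 1 B.N) (c : Plane) :
    |B.jump U i| ≤ 2 * Real.sin (Real.pi - B.αt i) *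
      (‖elementGradient U (B.Kt i) - c‖ + ‖elementGradient U (B.K i) - c‖
        + ‖elementGradient U (B.K (i - 1)) - c‖) := by
  have hKt := B.Kt_mem i hi
  obtain ⟨i, rfl⟩ := Nat.exists_eq_add_of_le' (Finset.mem_Icc.1 hi).1
  have hiN : i + 1 ≤ B.N := (Finset.mem_Icc.1 hi).2
  obtain ⟨hδ, hδ₁, hδ₂⟩ := B.norm_normalize_edge_sub_le hiN
  refine abs_inner_sub_le c ?_ ?_ hδ hδ₁ hδ₂
  · exact inner_elementGradient_eq hU hKt (B.K_mem i (by omega))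
      ⟨left_mem_body_tri _ _ _, middle_mem_body_tri _ _ _⟩
      ⟨middle_mem_body_tri _ _ _, right_mem_body_tri _ _ _⟩
  · exact inner_elementGradient_eq hU hKt (B.K_mem (i + 1) hiN)
      ⟨right_mem_body_tri _ _ _, right_mem_body_tri _ _ _⟩
      ⟨left_mem_body_tri _ _ _, left_mem_body_tri _ _ _⟩

end Band

section LowerBound

variable {T : Geometry.SimplicialComplex ℝ Plane} {Ω : Set Plane} {U : Plane → ℝ}

lemma one_div_sq_mul_sq_le {J σ x y z : ℝ} (h : |J| ≤ 2 * σ * (x + y + z)) :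
    1 / σ ^ 2 * J ^ 2 ≤ 12 * (x ^ 2 + y ^ 2 + z ^ 2) := by
  calc 1 / σ ^ 2 * J ^ 2 ≤ 1 / σ ^ 2 * (2 * σ * (x + y + z)) ^ 2 := by
        rw [← sq_abs J]
        gcongr
    _ = σ ^ 2 / σ ^ 2 * (4 * (x + y + z) ^ 2) := by ring
    _ ≤ 1 * (4 * (3 * (x ^ 2 + y ^ 2 + z ^ 2))) := by
        gcongr
        · exact div_self_le_one _
        · linarith [sq_nonneg (x - y), sq_nonneg (x - z), sq_nonneg (y - z)]
    _ = 12 * (x ^ 2 + y ^ 2 + z ^ 2) := by ring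

lemma Band.weighted_jump_sq_le (B : Band T) (hU : U ∈ X T) {h : ℝ}
    (hh : ∀ s ∈ elements T, Metric.diam (body s) ≤ h) {CK : ℝ} (hCK : 0 ≤ CK) {i : ℕ}
    (hi : i ∈ Finset.Icc 1 B.N) (hK : area (B.Kt i) ≤ CK * area (B.K i))
    (hK' : area (B.Kt i) ≤ CK * area (B.K (i - 1))) :
    1 / Real.sin (Real.pi - B.αt i) ^ 2 * area (B.Kt i) * B.jump U i ^ 2 ≤
      12 * (errorIndicator U h (B.Kt i) + CK * errorIndicator U h (B.K i)
        + CK * errorIndicator U h (B.K (i - 1))) := by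
  obtain ⟨hi₁, hiN⟩ := Finset.mem_Icc.1 hi
  have hp : B.p i ∈ body (B.K (i - 1)) := by
    rw [Band.K, Nat.sub_add_cancel hi₁]
    exact middle_mem_body_tri _ _ _
  have hKt_mem : B.Kt i ∈ elements T := B.Kt_mem i hi
  have hK_mem : B.K i ∈ elements T := B.K_mem i hiN
  have hK_mem' : B.K (i - 1) ∈ elements T := B.K_mem (i - 1) (by omega)
  have hindicator {s : Finset Plane} (hs : s ∈ elements T) (hps : B.p i ∈ body s) :=
    area_mul_norm_elementGradient_sub_sq_le hU hs hps (hh s hs)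
  have hcompare {s : Finset Plane} (hs : s ∈ elements T) (hps : B.p i ∈ body s)
      (harea : area (B.Kt i) ≤ CK * area s) :
      area (B.Kt i) * ‖elementGradient U s - (2 : ℝ) • B.p i‖ ^ 2
        ≤ CK * errorIndicator U h s :=
    (mul_le_mul_of_nonneg_right harea (sq_nonneg _)).trans <|
      (mul_assoc CK _ _).trans_le (mul_le_mul_of_nonneg_left (hindicator hs hps) hCK)
  calc 1 / Real.sin (Real.pi - B.αt i) ^ 2 * area (B.Kt i) * B.jump U i ^ 2
      = area (B.Kt i) * (1 / Real.sin (Real.pi - B.αt i) ^ 2 * B.jump U i ^ 2) := by ring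
    _ ≤ area (B.Kt i) * (12 * (‖elementGradient U (B.Kt i) - (2 : ℝ) • B.p i‖ ^ 2
          + ‖elementGradient U (B.K i) - (2 : ℝ) • B.p i‖ ^ 2
          + ‖elementGradient U (B.K (i - 1)) - (2 : ℝ) • B.p i‖ ^ 2)) :=
        mul_le_mul_of_nonneg_left (one_div_sq_mul_sq_le (B.abs_jump_le hU hi _)) measureReal_nonneg
    _ ≤ _ := by
        linarith [hindicator hKt_mem (left_mem_body_tri _ _ _),
          hcompare hK_mem (left_mem_body_tri _ _ _) hK, hcompare hK_mem' hp hK']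

/-- The contribution of a band to the sum in the lower bound for the error. -/
noncomputable def Band.contribution (B : Band T) : ℝ :=
  B.minOver (fun i => 1 / Real.sin (Real.pi - B.αt i) ^ 2) *
    B.minOver (fun i => area (B.Kt i)) * B.L ^ 2 / (B.N : ℝ)

lemma Band.contribution_le (B : Band T) {κ : ℝ}
    (hL : B.L ≤ κ * ∑ i ∈ Finset.Icc 1 B.N, |B.jump U i|) :
    B.contribution ≤ κ ^ 2 * ∑ i ∈ Finset.Icc 1 B.N,
      1 / Real.sin (Real.pi - B.αt i) ^ 2 * area (B.Kt i) * B.jump U i ^ 2 := by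
  rw [contribution]
  set a := B.minOver (fun i => 1 / Real.sin (Real.pi - B.αt i) ^ 2)
  set e := B.minOver (fun i => area (B.Kt i))
  have ha₀ : 0 ≤ a := Finset.le_inf' _ _ fun i _ => by positivity
  have he₀ : 0 ≤ e := Finset.le_inf' _ _ fun i _ => measureReal_nonneg
  have hN : (0 : ℝ) < B.N := Nat.cast_pos.2 B.one_le_N
  have hsq : B.L ^ 2 ≤ κ ^ 2 * (B.N * ∑ i ∈ Finset.Icc 1 B.N, B.jump U i ^ 2) := by
    have hcauchy := sq_sum_le_card_mul_sum_sq (s := Finset.Icc 1 B.N)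
      (f := fun i => |B.jump U i|)
    simp only [sq_abs, Nat.card_Icc, Nat.add_sub_cancel] at hcauchy
    calc B.L ^ 2 ≤ (κ * ∑ i ∈ Finset.Icc 1 B.N, |B.jump U i|) ^ 2 :=
          pow_le_pow_left₀ B.L_pos.le hL 2
      _ ≤ _ := by rw [mul_pow]; gcongr
  calc a * e * B.L ^ 2 / B.N
      ≤ a * e * (κ ^ 2 * (B.N * ∑ i ∈ Finset.Icc 1 B.N, B.jump U i ^ 2)) / B.N := by gcongr
    _ = κ ^ 2 * ∑ i ∈ Finset.Icc 1 B.N, a * e * B.jump U i ^ 2 := by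
        rw [← Finset.mul_sum]
        field_simp
    _ ≤ _ := by
        gcongr with i hi
        exacts [Finset.inf'_le _ hi, Finset.inf'_le _ hi]

lemma sum_bands_errorIndicator_le {ι : Type*} [Fintype ι] {B : ι → Band T}
    (hB : ∀ b b', b ≠ b' → Disjoint (B b).elems (B b').elems) {k : ι → ℕ → Finset Plane}
    (hk : ∀ b, ∀ i ∈ Finset.Icc 1 (B b).N, k b i ∈ (B b).elems)
    (hinj : ∀ b, InjOn (k b) (Finset.Icc 1 (B b).N)) {S : Set Plane}
    (hS : ⋃ b, (B b).region ⊆ S) (hv : SegmentwiseH1On (err U) S) (hfin : volume S ≠ ⊤) (h : ℝ) :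
    ∑ b, ∑ i ∈ Finset.Icc 1 (B b).N, errorIndicator U h (k b i)
      ≤ 2 * h1Seminorm S (err U) ^ 2 + 8 * h ^ 2 * volume.real S := by
  rw [Finset.sum_sigma' Finset.univ (fun b => Finset.Icc 1 (B b).N)
    (fun b i => errorIndicator U h (k b i))]
  refine sum_errorIndicator_le (T := T) hv hfin (k := fun z : (_ : ι) × ℕ => k z.1 z.2) ?_ ?_ ?_ h
  · rintro ⟨b, i⟩ hi ⟨b', i'⟩ hi' (heq : k b i = k b' i')
    have hi := (Finset.mem_sigma.1 hi).2
    have hi' := (Finset.mem_sigma.1 hi').2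
    obtain rfl : b = b' := by
      by_contra hne
      exact disjoint_left.1 (hB b b' hne) (hk b i hi) (heq ▸ hk b' i' hi')
    exact congrArg (Sigma.mk b) (hinj b hi hi' heq)
  · exact fun z hz => (B z.1).elems_subset_elements (hk z.1 z.2 (Finset.mem_sigma.1 hz).2)
  · exact fun z hz => (subset_biUnion_of_mem (u := body)
      (hk z.1 z.2 (Finset.mem_sigma.1 hz).2)).trans
      ((subset_iUnion (fun b => (B b).region) z.1).trans hS)

lemma sum_contribution_le (hT : IsTriangulation T Ω) (hΩ : IsOpen Ω) (hU : U ∈ X T) {h : ℝ}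
    (hh : ∀ s ∈ elements T, Metric.diam (body s) ≤ h) {CK : ℝ} (hCK : 0 ≤ CK) {ι : Type*}
    [Fintype ι] {B : ι → Band T} (hB : ∀ b b', b ≠ b' → Disjoint (B b).elems (B b').elems)
    (hK : ∀ b, ∀ i ∈ Finset.Icc 1 (B b).N, area ((B b).Kt i) ≤ CK * area ((B b).K i) ∧
      area ((B b).Kt i) ≤ CK * area ((B b).K (i - 1)))
    {κ : ℝ} (hL : ∀ b, (B b).L ≤ κ * ∑ i ∈ Finset.Icc 1 (B b).N, |(B b).jump U i|) :
    ∑ b, (B b).contribution ≤ κ ^ 2 * (24 * h1Seminorm (⋃ b, (B b).region) (err U) ^ 2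
      + (48 * CK * h1Seminorm (closure Ω) (err U) ^ 2
        + (96 + 192 * CK) * volume.real (closure Ω) * h ^ 2)) := by
  have hv := segmentwiseH1On_err hT hΩ hU
  have hreg : ⋃ b, (B b).region ⊆ closure Ω :=
    iUnion_subset fun b => (B b).region_subset_closure hT
  have hfin : volume (closure Ω) ≠ ⊤ := hT.isCompact_closure.measure_ne_top
  have hvol : volume.real (⋃ b, (B b).region) ≤ volume.real (closure Ω) :=
    measureReal_mono hreg hfin
  have hKt_sum := sum_bands_errorIndicator_le hB (k := fun b => (B b).Kt)
    (fun b i hi => Or.inr ⟨i, hi, rfl⟩) (fun b => (B b).Kt_injOn) subset_rfl (hv.mono hreg)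
    (measure_ne_top_of_subset hreg hfin) h
  have hK_sum := sum_bands_errorIndicator_le hB (k := fun b => (B b).K)
    (fun b i hi => Or.inl ⟨i, (Finset.mem_Icc.1 hi).2, rfl⟩)
    (fun b => (B b).K_injOn.mono fun i hi => (Finset.mem_Icc.1 hi).2) hreg hv hfin h
  have hK_pred_sum := sum_bands_errorIndicator_le hB (k := fun b i => (B b).K (i - 1))
    (fun b i hi => Or.inl ⟨i - 1, by grind, rfl⟩)
    (fun b i hi j hj hij => by
      have := (B b).K_injOn (x₁ := i - 1) (x₂ := j - 1) (by grind) (by grind) hij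
      grind) hreg hv hfin h
  have hcontribution (b : ι) := ((B b).contribution_le (hL b)).trans <|
    mul_le_mul_of_nonneg_left (Finset.sum_le_sum fun i hi =>
      (B b).weighted_jump_sq_le hU hh hCK hi (hK b i hi).1 (hK b i hi).2) (sq_nonneg κ)
  refine (Finset.sum_le_sum fun b _ => hcontribution b).trans ?_
  simp only [← Finset.mul_sum, Finset.sum_add_distrib]
  refine mul_le_mul_of_nonneg_left ?_ (sq_nonneg κ)
  linarith [mul_le_mul_of_nonneg_left hK_sum hCK, mul_le_mul_of_nonneg_left hK_pred_sum hCK,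
    mul_le_mul_of_nonneg_left hvol (sq_nonneg h)]

end LowerBound

section EdgeLength

variable {T : Geometry.SimplicialComplex ℝ Plane} {Ω : Set Plane} {U : Plane → ℝ}

lemma Band.sq_le_abs_err_second_difference (B : Band T) (hU : U ∈ X T) {t m : ℝ} (ht : 0 ≤ t)
    (hm : 0 ≤ m) (htm : t + m + m ≤ B.L) (hjump : 2 * ∑ i ∈ Finset.Icc 1 B.N, |B.jump U i| ≤ m) :
    m ^ 2 ≤ |err U (B.p 0 + (t + m + m) • B.g) - err U (B.p 0 + (t + m) • B.g)
      - (err U (B.p 0 + (t + m) • B.g) - err U (B.p 0 + t • B.g))| := by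
  set τ := ∑ i ∈ Finset.Icc 1 B.N, |B.jump U i|
  have hvar {x : ℝ} (hx : 0 ≤ x) (hx' : x + m ≤ B.L) :
      |U (B.p 0 + (x + m) • B.g) - U (B.p 0 + x • B.g) - B.slope U 0 * m| ≤ τ * m := by
    simpa only [add_sub_cancel_left, τ, Band.jump] using
      abs_sub_sub_le_of_slope_variation (w := fun x => U (B.p 0 + x • B.g))
        (fun i hi => (B.p_succ_and_abscissa_lt_succ hi).2.le)
        (fun i hi x hx y hy => B.sub_eq_slope_mul hU hi hx hy)
        (B.abscissa_zero.trans_le hx) (le_add_of_nonneg_right hm) (hx'.trans_eq B.L_eq_abscissa)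
  have hvar₁ := abs_le.1 (hvar ht (by linarith))
  have hvar₂ := abs_le.1 (hvar (by linarith) htm)
  have hquad := uExact_second_difference B.norm_g (B.p 0) t m
  have hτ := mul_le_mul_of_nonneg_right hjump hm
  refine le_trans ?_ (le_abs_self _)
  simp only [err]
  linarith [hvar₁.1, hvar₂.2]

lemma Band.L_le_diam (B : Band T) (hT : IsTriangulation T Ω) : B.L ≤ Metric.diam (closure Ω) :=
  Metric.dist_le_diam_of_mem hT.isCompact_closure.isBounded
    (hT.body_subset_closure (B.K_mem 0 (Nat.zero_le _)) (left_mem_body_tri _ _ _))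
    (hT.body_subset_closure (B.K_mem B.N le_rfl) (middle_mem_body_tri _ _ _))

lemma Band.pow_four_le_of_sum_abs_jump_le (B : Band T) (hT : IsTriangulation T Ω) (hΩ : IsOpen Ω)
    (hU : U ∈ X T) {F : Finset (Finset Plane)} (hF : F.Nonempty)
    (hcover : closure Ω = ⋃ s ∈ F, body s) {r : ℝ} (hr : 0 < r)
    (hball : ∀ s ∈ F, ∃ z, Metric.ball z r ⊆ body s)
    (hjump : 2 * ∑ i ∈ Finset.Icc 1 B.N, |B.jump U i| ≤ B.L / (6 * F.card)) :
    (B.L / (6 * F.card)) ^ 4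
      ≤ 216 * (Metric.diam (closure Ω) / r) * h1Seminorm (closure Ω) (err U) ^ 2 := by
  have : (0 : ℝ) < F.card := Nat.cast_pos.2 hF.card_pos
  set m := B.L / (6 * F.card) with hm
  have hm₀ : 0 < m := div_pos B.L_pos (by positivity)
  have h6m : B.L / F.card = 6 * m := by rw [hm]; field_simp
  obtain ⟨s, hs, a, ha₀, haL, hsa, hsa'⟩ := exists_subsegment_mem hF (P := body)
    (fun s _ => convex_body s) (fun s _ => isClosed_body s) B.L_pos
    fun t ht => hcover ▸ B.add_smul_mem_closure hT ht
  rw [h6m] at haL hsa'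
  have hsub : body s ⊆ closure Ω := hcover ▸ subset_biUnion_of_mem (u := body) hs
  obtain ⟨z, hz⟩ := hball s hs
  have hv := segmentwiseH1On_err hT hΩ hU
  have hlocal := (hv.mono hsub).sq_le_h1Seminorm_of_second_difference (convex_body s)
    (isClosed_body s).measurableSet (isCompact_body s).isBounded hr hz B.norm_g hm₀
    (sq_nonneg m) hsa (by rwa [add_assoc, ← add_smul]) fun t ht => by
      simpa only [add_smul, add_assoc] using B.sq_le_abs_err_second_difference hU
        (t := a + t) (by linarith [ht.1]) hm₀.le (by linarith [ht.2]) hjump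
  calc m ^ 4 = (m ^ 2) ^ 2 := by ring
    _ ≤ 216 * (Metric.diam (body s) / r) * h1Seminorm (body s) (err U) ^ 2 := hlocal
    _ ≤ _ := mul_le_mul
      (by gcongr; exact Metric.diam_mono hsub hT.isCompact_closure.isBounded)
      (hv.h1Seminorm_sq_mono hsub) (sq_nonneg _) (by positivity)

lemma exists_ball_subset_body {F : Finset (Finset Plane)} (hF : F.Nonempty)
    (htri : ∀ s ∈ F, s.card = 3 ∧ AffineIndependent ℝ ((↑) : s → Plane)) :
    ∃ r > 0, ∀ s ∈ F, ∃ z, Metric.ball z r ⊆ body s := by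
  have hball : ∀ s ∈ F, ∃ z, ∃ r > 0, Metric.ball z r ⊆ body s := fun s hs => by
    obtain ⟨z, hz⟩ := interior_convexHull_nonempty (htri s hs).2
      (by rw [(htri s hs).1, finrank_euclideanSpace_fin])
    exact ⟨z, Metric.mem_nhds_iff.1 (mem_interior_iff_mem_nhds.1 hz)⟩
  choose! z ρ hρ hsub using hball
  exact ⟨F.inf' hF ρ, (Finset.lt_inf'_iff hF).2 hρ, fun s hs =>
    ⟨z s, (Metric.ball_subset_ball (Finset.inf'_le ρ hs)).trans (hsub s hs)⟩⟩

lemma exists_length_le_sum_abs_jump_or_pow_five_le (hne : Ω.Nonempty) (hΩ : IsOpen Ω)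
    (hpoly : ∃ F : Finset (Finset Plane),
      (∀ s ∈ F, s.card = 3 ∧ AffineIndependent ℝ ((↑) : s → Plane)) ∧
        closure Ω = ⋃ s ∈ F, body s) :
    ∃ κ > 0, ∃ W ≥ 0, ∀ (T : Geometry.SimplicialComplex ℝ Plane) (U : Plane → ℝ),
      IsTriangulation T Ω → U ∈ X T → ∀ B : Band T,
        B.L ≤ κ * ∑ i ∈ Finset.Icc 1 B.N, |B.jump U i| ∨
          B.L ^ 5 ≤ W * h1Seminorm (closure Ω) (err U) ^ 2 := by
  obtain ⟨F, htri, hcover⟩ := hpoly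
  have hF : F.Nonempty := by
    obtain ⟨s, hs, -⟩ := mem_iUnion₂.1 (hcover ▸ subset_closure hne.some_mem)
    exact ⟨s, hs⟩
  have : (0 : ℝ) < F.card := Nat.cast_pos.2 hF.card_pos
  obtain ⟨r, hr, hball⟩ := exists_ball_subset_body hF htri
  set D := Metric.diam (closure Ω)
  have : 0 ≤ D := Metric.diam_nonneg
  refine ⟨12 * F.card, by positivity, (6 * F.card) ^ 4 * (216 * (D / r)) * D, by positivity,
    fun T U hT hU B => or_iff_not_imp_left.2 fun hlong => ?_⟩
  have hjump : 2 * ∑ i ∈ Finset.Icc 1 B.N, |B.jump U i| ≤ B.L / (6 * F.card) := by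
    rw [le_div_iff₀ (by positivity)]
    linarith
  have hfour := B.pow_four_le_of_sum_abs_jump_le hT hΩ hU hF hcover hr hball hjump
  rw [div_pow, div_le_iff₀ (by positivity)] at hfour
  calc B.L ^ 5 = B.L ^ 4 * B.L := pow_succ _ _
    _ ≤ 216 * (D / r) * h1Seminorm (closure Ω) (err U) ^ 2 * (6 * F.card) ^ 4 * D :=
        mul_le_mul hfour (B.L_le_diam hT) B.L_pos.le (by positivity)
    _ = _ := by ring

lemma mul_sq_lt_pow_five {W C y h α L : ℝ} (hW : 0 ≤ W) (hh : 0 < h) (hy₀ : 0 ≤ y)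
    (hy : y ≤ C * h ^ α) (hL : (1 + W * C ^ 2) * h ^ (2 * α / 5) ≤ L) : W * y ^ 2 < L ^ 5 := by
  have hpow : (h ^ α) ^ 2 = (h ^ (2 * α / 5)) ^ 5 := by
    rw [← Real.rpow_mul_natCast hh.le, ← Real.rpow_mul_natCast hh.le]
    congr 1
    push_cast
    ring
  have : 0 < h ^ (2 * α / 5) := Real.rpow_pos_of_pos hh _
  have hWC : 0 ≤ W * C ^ 2 := by positivity
  calc W * y ^ 2 ≤ W * (C * h ^ α) ^ 2 := by gcongr
    _ = W * C ^ 2 * (h ^ (2 * α / 5)) ^ 5 := by rw [mul_pow, hpow, mul_assoc]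
    _ < (1 + W * C ^ 2) ^ 5 * (h ^ (2 * α / 5)) ^ 5 := by
        gcongr
        exact (lt_one_add _).trans_le (le_self_pow₀ (by linarith) (by norm_num))
    _ = ((1 + W * C ^ 2) * h ^ (2 * α / 5)) ^ 5 := (mul_pow _ _ _).symm
    _ ≤ L ^ 5 := by gcongr

end EdgeLength

section Constants

variable {T : Geometry.SimplicialComplex ℝ Plane} {Ω : Set Plane} {h : ℝ}

lemma IsMeshSize.pos (hh : IsMeshSize T h) : 0 < h := by
  obtain ⟨s, hs, rfl⟩ := hh.1
  obtain ⟨x, hx, y, hy, hxy⟩ := Finset.one_lt_card.1 (hs.2 ▸ (by norm_num : 1 < 3))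
  exact (dist_pos.2 hxy).trans_le (Metric.dist_le_diam_of_mem (isCompact_body s).isBounded
    (mem_body_of_mem hx) (mem_body_of_mem hy))

lemma IsMeshSize.le_mul_rpow (hh : IsMeshSize T h) (hT : IsTriangulation T Ω) {α : ℝ}
    (hα : α ≤ 1) : h ≤ Metric.diam (closure Ω) ^ (1 - α) * h ^ α := by
  have hle : h ≤ Metric.diam (closure Ω) := by
    obtain ⟨s, hs, rfl⟩ := hh.1
    exact Metric.diam_mono (hT.body_subset_closure hs) hT.isCompact_closure.isBounded
  have hh₀ := hh.pos
  calc h = h ^ (1 - α) * h ^ α := by rw [← Real.rpow_add hh₀, sub_add_cancel, Real.rpow_one]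
    _ ≤ _ := by gcongr

lemma sqrt_le_mul_add {S κ a Z x : ℝ} (hκ : 0 ≤ κ) (ha : 0 ≤ a) (hZ : 0 ≤ Z) (hx : 0 ≤ x)
    (hS : S ≤ κ ^ 2 * (24 * a ^ 2 + Z * x ^ 2)) : √S ≤ κ * (5 * a + √Z * x) := by
  refine (Real.sqrt_le_left (by positivity)).2 (hS.trans ?_)
  have hcross : 0 ≤ a * (√Z * x) := by positivity
  calc κ ^ 2 * (24 * a ^ 2 + Z * x ^ 2) = κ ^ 2 * (24 * a ^ 2 + (√Z * x) ^ 2) := by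
        rw [mul_pow √Z, Real.sq_sqrt hZ]
    _ ≤ κ ^ 2 * (5 * a + √Z * x) ^ 2 := by
        gcongr
        linarith [sq_nonneg a]
    _ = (κ * (5 * a + √Z * x)) ^ 2 := (mul_pow _ _ _).symm

end Constants

section MainBound

variable {T : Geometry.SimplicialComplex ℝ Plane} {Ω : Set Plane} {U : Plane → ℝ} {h α : ℝ}

lemma sqrt_sum_contribution_le (hT : IsTriangulation T Ω) (hΩ : IsOpen Ω) (hU : U ∈ X T)
    (hh : IsMeshSize T h) (hα : α ≤ 1) {Cu : ℝ}
    (herr : h1Seminorm (closure Ω) (err U) ≤ Cu * h ^ α) {CK : ℝ} {ι : Type*} [Fintype ι]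
    {B : ι → Band T} (hB : ∀ b b', b ≠ b' → Disjoint (B b).elems (B b').elems)
    (hK : ∀ b, ∀ i ∈ Finset.Icc 1 (B b).N, area ((B b).Kt i) ≤ CK * area ((B b).K i) ∧
      area ((B b).Kt i) ≤ CK * area ((B b).K (i - 1)))
    {κ : ℝ} (hκ : 0 ≤ κ)
    (hL : ∀ b, (B b).L ≤ κ * ∑ i ∈ Finset.Icc 1 (B b).N, |(B b).jump U i|) :
    √(∑ b, (B b).contribution) ≤ κ * (5 * h1Seminorm (⋃ b, (B b).region) (err U)
      + √(48 * |CK| * Cu ^ 2 + (96 + 192 * |CK|) * volume.real (closure Ω)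
        * (Metric.diam (closure Ω) ^ (1 - α)) ^ 2) * h ^ α) := by
  have : 0 ≤ volume.real (closure Ω) := measureReal_nonneg
  have hK' (b : ι) (i : ℕ) (hi : i ∈ Finset.Icc 1 (B b).N) :
      area ((B b).Kt i) ≤ |CK| * area ((B b).K i) ∧
        area ((B b).Kt i) ≤ |CK| * area ((B b).K (i - 1)) :=
    (hK b i hi).imp
      (fun hle => hle.trans (mul_le_mul_of_nonneg_right (le_abs_self CK) measureReal_nonneg))
      (fun hle => hle.trans (mul_le_mul_of_nonneg_right (le_abs_self CK) measureReal_nonneg))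
  have herr_sq : h1Seminorm (closure Ω) (err U) ^ 2 ≤ (Cu * h ^ α) ^ 2 :=
    pow_le_pow_left₀ (h1Seminorm_nonneg _ _) herr 2
  have hh_sq : h ^ 2 ≤ (Metric.diam (closure Ω) ^ (1 - α) * h ^ α) ^ 2 :=
    pow_le_pow_left₀ hh.pos.le (hh.le_mul_rpow hT hα) 2
  refine sqrt_le_mul_add hκ (h1Seminorm_nonneg _ _) (by positivity)
    (Real.rpow_nonneg hh.pos.le α) ?_
  calc ∑ b, (B b).contribution
      ≤ κ ^ 2 * (24 * h1Seminorm (⋃ b, (B b).region) (err U) ^ 2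
        + (48 * |CK| * h1Seminorm (closure Ω) (err U) ^ 2
          + (96 + 192 * |CK|) * volume.real (closure Ω) * h ^ 2)) :=
        sum_contribution_le hT hΩ hU (fun s hs => hh.2 ⟨s, hs, rfl⟩) (abs_nonneg CK) hB hK' hL
    _ ≤ κ ^ 2 * (24 * h1Seminorm (⋃ b, (B b).region) (err U) ^ 2
        + (48 * |CK| * (Cu * h ^ α) ^ 2 + (96 + 192 * |CK|) * volume.real (closure Ω)
          * (Metric.diam (closure Ω) ^ (1 - α) * h ^ α) ^ 2)) := by gcongr
    _ = _ := by ring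

end MainBound

end FEMBand

open FEMBand in
theorem theorem2p2_general {Ω : Set Plane} (hne : Ω.Nonempty) (hΩ : interior (closure Ω) = Ω)
    (hpoly : ∃ F : Finset (Finset Plane),
      (∀ s ∈ F, s.card = 3 ∧ AffineIndependent ℝ ((↑) : s → Plane)) ∧
        closure Ω = ⋃ s ∈ F, body s)
    {α : ℝ} (hα : α ≤ 1) (Cu : ℝ) :
    ∃ CL > (0 : ℝ), ∃ C₁ > (0 : ℝ), ∀ CK : ℝ, ∃ C₂ > (0 : ℝ),
      ∀ (T : Geometry.SimplicialComplex ℝ Plane) (h : ℝ) (U : Plane → ℝ),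
        IsTriangulation T Ω → IsMeshSize T h → U ∈ X T → h1Seminorm Ω (err U) ≤ Cu * h ^ α →
        ∀ {ι : Type*} [Fintype ι] (B : ι → Band T),
          (∀ b b', b ≠ b' → Disjoint (B b).elems (B b').elems) →
          (∀ b, ∀ i ∈ Finset.Icc 1 (B b).N, area ((B b).Kt i) ≤ CK * area ((B b).K i) ∧
            area ((B b).Kt i) ≤ CK * area ((B b).K (i - 1))) →
          (∀ b, CL * h ^ (2 * α / 5) ≤ (B b).L) →
          ∃ A₁ A₂ : ℝ, A₁ - A₂ ≤ h1Seminorm (⋃ b, (B b).region) (err U) ∧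
            C₁ * √(∑ b, (B b).contribution) ≤ A₁ ∧ |A₂| ≤ C₂ * h ^ α := by
  have hopen : IsOpen Ω := hΩ ▸ isOpen_interior
  obtain ⟨κ, hκ, W, hW, hlength⟩ := exists_length_le_sum_abs_jump_or_pow_five_le hne hopen hpoly
  refine ⟨1 + W * Cu ^ 2, by positivity, 1 / (5 * κ), by positivity, fun CK => ?_⟩
  set Z := 48 * |CK| * Cu ^ 2 + (96 + 192 * |CK|) * volume.real (closure Ω)
    * (Metric.diam (closure Ω) ^ (1 - α)) ^ 2
  refine ⟨√Z + 1, by positivity, fun T h U hT hh hU herr ι _ B hB hK hL => ?_⟩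
  have hhα : 0 ≤ h ^ α := Real.rpow_nonneg hh.pos.le α
  rw [← hT.h1Seminorm_closure hΩ] at herr
  have hlong (b : ι) : (B b).L ≤ κ * ∑ i ∈ Finset.Icc 1 (B b).N, |(B b).jump U i| :=
    (hlength T U hT hU (B b)).resolve_right
      (mul_sq_lt_pow_five hW hh.pos (h1Seminorm_nonneg _ _) herr (hL b)).not_ge
  have hsqrt := sqrt_sum_contribution_le hT hopen hU hh hα herr hB hK hκ.le hlong
  refine ⟨_, √Z / 5 * h ^ α, ?_, le_rfl, ?_⟩
  · rw [sub_le_iff_le_add, one_div_mul_eq_div, div_le_iff₀ (by positivity)]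
    linarith
  · rw [abs_of_nonneg (by positivity)]
    gcongr
    linarith [Real.sqrt_nonneg Z]

theorem theorem2p2
    (Ω : Set FEMBand.Plane) (hΩ : FEMBand.IsPolygonalDomain Ω)
    (α : ℝ) (hα₀ : 0 ≤ α) (hα₁ : α ≤ 1) (Cu : ℝ) :
    -- constants depending only on the domain, the exponent and the constant of the error estimate
    ∃ CL > (0 : ℝ), ∃ C₁ > (0 : ℝ), ∀ CK Cα : ℝ, ∃ C₂ > (0 : ℝ),
      ∀ (T : Geometry.SimplicialComplex ℝ FEMBand.Plane) (h : ℝ) (U : FEMBand.Plane → ℝ),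
        FEMBand.IsTriangulation T Ω → FEMBand.IsMeshSize T h → U ∈ FEMBand.X T →
        -- the error estimate
        FEMBand.h1Seminorm Ω (fun x => FEMBand.uExact x - U x) ≤ Cu * h ^ α →
        ∀ (NB : ℕ) (B : Fin NB → FEMBand.Band T),
          -- the bands are disjoint families of elements
          (∀ b b', b ≠ b' → Disjoint (B b).elems (B b').elems) →
          (∀ b, ∀ i ∈ Finset.Icc 1 (B b).N,
            FEMBand.area ((B b).Kt i) ≤ CK * FEMBand.area ((B b).K i) ∧
            FEMBand.area ((B b).Kt i) ≤ CK * FEMBand.area ((B b).K (i - 1)) ∧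
            Real.sin (Real.pi - (B b).α (i - 1)) ≤
              Cα * Real.sin (Real.pi - (B b).αt i)) →
          (∀ b, CL * h ^ (2 * α / 5) ≤ (B b).L) →
          ∃ A₁ A₂ : ℝ,
            A₁ - A₂ ≤ FEMBand.h1Seminorm (⋃ b, (B b).region)
              (fun x => FEMBand.uExact x - U x) ∧
            C₁ * Real.sqrt (∑ b,
              (B b).minOver (fun i => 1 / Real.sin (Real.pi - (B b).αt i) ^ 2) *
              (B b).minOver (fun i => FEMBand.area ((B b).Kt i)) *
              (B b).L ^ 2 / ((B b).N : ℝ)) ≤ A₁ ∧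
            |A₂| ≤ C₂ * h ^ α := by
  obtain ⟨CL, hCL, C₁, hC₁, hbound⟩ := theorem2p2_general hΩ.isConnected.nonempty
    hΩ.interior_closure hΩ.polygonal hα₁ Cu
  exact ⟨CL, hCL, C₁, hC₁, fun CK _ => (hbound CK).imp fun C₂ hC₂ =>
    ⟨hC₂.1, fun T h U hT hh hU herr NB B hB hK hL => hC₂.2 T h U hT hh hU herr B hB
      (fun b i hi => ⟨(hK b i hi).1, (hK b i hi).2.1⟩) hL⟩⟩
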